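/- Let $(V,Y,\mathbf 1,\omega)$ be a vertex operator algebra over $\mathbb C$: $V=\coprod_{n\in\mathbb Z}V_{(n)}$ with $\dim V_{(n)}<\infty$ and $V_{(n)}=0$ for $n$ sufficiently negative. Write $Y(u,x)=\sum_{n\in\mathbb Z}u_nx^{-n-1}$ and $L(n)=\omega_{n+1}$. For $u,v\in V$ put $$u\bullet v=\mathrm{Res}_x\,\frac{2\pi i\,e^{2\pi ix}}{e^{2\pi ix}-1}\,Y(u,x)v ,$$ let $\tilde O(V)$ be the subspace of $V$ spanned by all elements $\mathrm{Res}_x\frac{2\pi i\,e^{2\pi ix}}{(e^{2\pi ix}-1)^n}Y(u,x)v$ with $n>1$ and $u,v\in V$, and let $\tilde A(V)=V/\tilde O(V)$. Let complex numbers $A_j$, $j\ge 1$, be determined by $$\exp\Big(\sum_{j\ge1}A_jy^{j+1}\frac{d}{dy}\Big)y=\frac1{2\pi i}\log(1+2\pi i y),$$ and let $\mathcal U(1)=(2\pi i)^{L(0)}e^{-\sum_{j\ge1}A_jL(j)}$ on $V$, where $(2\pi i)^{L(0)}$ is multiplication by $(2\pi i)^n$ on $V_{(n)}$. Let $A(V)=V/O(V)$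 be Zhu's algebra: $O(V)$ is spanned by all $\mathrm{Res}_x\frac{(1+x)^{\mathrm{wt}\,u}}{x^2}Y(u,x)v$ with $u$ homogeneous and $v\in V$, and its product is induced by $u*v=\mathrm{Res}_x\frac{(1+x)^{\mathrm{wt}\,u}}{x}Y(u,x)v$ for $u$ homogeneous, extended linearly in $u$. Then: 1. The product $\bullet$ induces a product on $\tilde A(V)$, and with it $\tilde A(V)$ is an associative algebra over $\mathbb C$ with identity $\mathbf 1+\tilde O(V)$. 2. For all $u,v\in V$, $(L(-1)u)\bullet v\in\tilde O(V)$ and $$u\bullet v\equiv v\bullet u-2\pi i\,v_0u\equiv v\bullet u+2\pi i\,u_0v \pmod{\tilde O(V)} .$$ Moreover $\omega+\tilde O(V)$ lies in the center of $\tilde A(V)$. 3. The product $*$ induces a product on $A(V)$, with which $A(V)$ is an associative algebra over $\mathbb C$ with identity $\mathbf 1+O(V)$, and $u+\tilde O(V)\mapsto \mathcal U(1)u+O(V)$ is a well-defined isomorphism of unital associative algebras $\tilde A(V)\to A(V)$. -/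

import Mathlib

open scoped VertexOperator

noncomputable section

/-! ### The coefficients `A_j` -/

/-- The formal vector field `(∑_{j ≥ 1} A_j y^{j+1}) d/dy` acting on `ℂ⟦y⟧`. -/
def flowField (A : ℕ → ℂ) (f : PowerSeries ℂ) : PowerSeries ℂ :=
  PowerSeries.mk (fun n => if 2 ≤ n then A (n - 1) else 0) * PowerSeries.derivative ℂ f

/-- The power series `(1 / 2πi) log (1 + 2πi y) = ∑_{m ≥ 1} (-1)^{m+1} (2πi)^{m-1} y^m / m`. -/
def scaledLog : PowerSeries ℂ :=
  PowerSeries.mk fun m =>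
    if m = 0 then 0 else (-1) ^ (m + 1) * (2 * Real.pi * Complex.I) ^ (m - 1) / m

/-- The identity `exp (∑_{j ≥ 1} A_j y^{j+1} d/dy) y = (1 / 2πi) log (1 + 2πi y)`, compared
coefficientwise. Since `flowField A` raises orders, `(flowField A)^k y` is divisible by `y^{k+1}`,
so the terms of the exponential with `k > m` do not contribute to the coefficient of `y^m`. -/
def IsLogFlow (A : ℕ → ℂ) : Prop :=
  ∀ m : ℕ, PowerSeries.coeff m
      (∑ k ∈ Finset.range (m + 1), ((k.factorial : ℂ)⁻¹) • (flowField A)^[k] PowerSeries.X) =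
    PowerSeries.coeff m scaledLog

theorem flowField_dvd (A : ℕ → ℂ) (k : ℕ) :
    (PowerSeries.X : PowerSeries ℂ) ^ (k + 1) ∣ (flowField A)^[k] PowerSeries.X := by
  induction k with
  | zero => simp
  | succ k ih =>
    rw [Function.iterate_succ_apply', PowerSeries.X_pow_dvd_iff]
    intro m hm
    rw [PowerSeries.X_pow_dvd_iff] at ih
    rw [flowField, PowerSeries.coeff_mul]
    refine Finset.sum_eq_zero fun p hp => ?_
    rw [Finset.HasAntidiagonal.mem_antidiagonal] at hp
    rw [PowerSeries.coeff_mk, PowerSeries.coeff_derivative]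
    split_ifs with h
    · rw [ih (p.2 + 1) (by omega)]; simp
    · simp

theorem flowField_congr {A B : ℕ → ℂ} {N : ℕ} (h : ∀ j, 1 ≤ j → j < N → A j = B j) (k n : ℕ)
    (hn : n < N + k) :
    PowerSeries.coeff n ((flowField A)^[k] PowerSeries.X) =
      PowerSeries.coeff n ((flowField B)^[k] PowerSeries.X) := by
  induction k generalizing n with
  | zero => rfl
  | succ k ih =>
    rw [Function.iterate_succ_apply', Function.iterate_succ_apply', flowField, flowField,
      PowerSeries.coeff_mul, PowerSeries.coeff_mul]
    refine Finset.sum_congr rfl fun p hp => ?_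
    rw [Finset.HasAntidiagonal.mem_antidiagonal] at hp
    simp only [PowerSeries.coeff_mk, PowerSeries.coeff_derivative]
    split_ifs with h2
    · rw [ih (p.2 + 1) (by omega)]
      by_cases hk : p.2 + 1 < k + 1
      · rw [PowerSeries.X_pow_dvd_iff.1 (flowField_dvd B k) _ hk]; simp
      · rw [h (p.1 - 1) (by omega) (by omega)]
    · simp

theorem coeff_flowField_one (A : ℕ → ℂ) (N : ℕ) (hN : 1 ≤ N) :
    PowerSeries.coeff (N + 1) (flowField A PowerSeries.X) = A N := by
  rw [flowField, PowerSeries.derivative_X, mul_one, PowerSeries.coeff_mk, if_pos (by omega)]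
  simp

/-- The part of the coefficient of `y^{N+1}` in the exponential that involves only the `A_j` with
`j < N`. -/
def flowRest (A : ℕ → ℂ) (N : ℕ) : ℂ :=
  PowerSeries.coeff (N + 1)
    (∑ k ∈ Finset.range N, (((k + 2).factorial : ℂ)⁻¹) • (flowField A)^[k + 2] PowerSeries.X)

theorem flowRest_congr {A B : ℕ → ℂ} {N : ℕ} (h : ∀ j, 1 ≤ j → j < N → A j = B j) :
    flowRest A N = flowRest B N := by
  simp only [flowRest, map_sum, PowerSeries.coeff_smul]
  refine Finset.sum_congr rfl fun k _ => ?_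
  rw [flowField_congr h (k + 2) (N + 1) (by omega)]

theorem isLogFlow_iff (A : ℕ → ℂ) :
    IsLogFlow A ↔ ∀ N, 1 ≤ N →
      A N = PowerSeries.coeff (N + 1) scaledLog - flowRest A N := by
  have key : ∀ N, 1 ≤ N → PowerSeries.coeff (N + 1) (∑ k ∈ Finset.range (N + 1 + 1),
      ((k.factorial : ℂ)⁻¹) • (flowField A)^[k] PowerSeries.X) = A N + flowRest A N := by
    intro N hN
    rw [Finset.sum_range_succ', Finset.sum_range_succ', map_add, map_add]
    have h1 := coeff_flowField_one A N hN
    simp only [flowRest, Function.iterate_zero, id, zero_add, Function.iterate_one,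
      PowerSeries.coeff_smul, h1, PowerSeries.coeff_X, add_assoc]
    rw [if_neg (by omega)]
    norm_num
    rw [add_comm]
  constructor
  · intro h N hN
    have := h (N + 1)
    rw [key N hN] at this
    rw [← this]; ring
  · intro h m
    match m with
    | 0 => simp [scaledLog]
    | 1 =>
      have : PowerSeries.coeff 1 (flowField A PowerSeries.X) = 0 :=
        PowerSeries.X_pow_dvd_iff.1 (flowField_dvd A 1) 1 (by norm_num)
      simp [scaledLog, Finset.sum_range_succ, this]
    | N + 2 =>
      rw [key (N + 1) (by omega), h (N + 1) (by omega)]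
      ring

/-- There is exactly one sequence `(A_j)_{j ≥ 1}` (with the dummy entry `A_0 = 0`) that
satisfies the defining identity. -/
theorem existsUnique_logFlow : ∃! A : ℕ → ℂ, A 0 = 0 ∧ IsLogFlow A := by
  let F : (n : ℕ) → ((m : ℕ) → m < n → ℂ) → ℂ := fun n prev =>
    if n = 0 then 0 else PowerSeries.coeff (n + 1) scaledLog -
      flowRest (fun m => if h : m < n then prev m h else 0) n
  let A : ℕ → ℂ := fun n => Nat.strongRec F n
  have hA : ∀ n, A n = F n (fun m _ => A m) := fun n => Nat.strongRec_eq F n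
  refine ⟨A, ⟨?_, ?_⟩, ?_⟩
  · rw [hA]; simp [F]
  · rw [isLogFlow_iff]
    intro N hN
    rw [hA]
    simp only [F]
    rw [if_neg (by omega)]
    congr 1
    refine flowRest_congr fun j _ hj => ?_
    simp [hj]
  · rintro B ⟨hB0, hB⟩
    rw [isLogFlow_iff] at hB
    have hA' : ∀ N, 1 ≤ N → A N = PowerSeries.coeff (N + 1) scaledLog - flowRest A N := by
      intro N hN
      rw [hA]
      simp only [F]
      rw [if_neg (by omega)]
      congr 1
      refine flowRest_congr fun j _ hj => ?_
      simp [hj]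
    funext n
    induction n using Nat.strong_induction_on with
    | _ n ih =>
      by_cases hn : n = 0
      · subst hn; rw [hB0, hA]; simp [F]
      · rw [hB n (by omega), hA' n (by omega), flowRest_congr fun j _ hj => ih j hj]

/-- The complex numbers `A_j`, `j ≥ 1`, determined by
`exp (∑_{j ≥ 1} A_j y^{j+1} d/dy) y = (1 / 2πi) log (1 + 2πi y)`. -/
def logFlowCoeff : ℕ → ℂ := Classical.choose existsUnique_logFlow.exists

theorem logFlowCoeff_spec : logFlowCoeff 0 = 0 ∧ IsLogFlow logFlowCoeff :=
  Classical.choose_spec existsUnique_logFlow.exists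

/-! ### Vertex operator algebras -/

/-- A vertex operator algebra `(V, Y, 𝟏, ω)` over `ℂ`. The vertex operator
`Y(u, x) v = ∑ₙ (uₙ v) x^{-n-1}` takes values in `V((x))`, and `(Y u)[[n]]` is the mode `uₙ`. -/
structure VertexOperatorAlgebra (V : Type*) [AddCommGroup V] [Module ℂ V] where
  /-- The vertex operator map. -/
  Y : V →ₗ[ℂ] VertexOperator ℂ V
  /-- The vacuum vector. -/
  vacuum : V
  /-- The conformal vector. -/
  omega : V
  /-- The central charge. -/
  centralCharge : ℂ
  /-- The homogeneous subspaces `V_(n)`. -/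
  grade : ℤ → Submodule ℂ V
  isInternal_grade : DirectSum.IsInternal grade
  finiteDimensional_grade : ∀ n, FiniteDimensional ℂ (grade n)
  grade_eq_bot : ∃ N : ℤ, ∀ n < N, grade n = ⊥
  vacuum_mem : vacuum ∈ grade 0
  omega_mem : omega ∈ grade 2
  /-- `Y(𝟏, x) = id`. -/
  vacuum_mode : ∀ (n : ℤ) (v : V), ((Y vacuum)[[n]]) v = if n = -1 then v else 0
  /-- `Y(v, x) 𝟏 ∈ V⟦x⟧` with constant term `v`. -/
  creation : ∀ v : V, ((Y v)[[(-1)]]) vacuum = v ∧ ∀ n : ℤ, 0 ≤ n → ((Y v)[[n]]) vacuum = 0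
  /-- The Jacobi identity
  `x₀⁻¹ δ((x₁ - x₂)/x₀) Y(u, x₁) Y(v, x₂) - x₀⁻¹ δ((x₂ - x₁)/(-x₀)) Y(v, x₂) Y(u, x₁)
    = x₂⁻¹ δ((x₁ - x₀)/x₂) Y(Y(u, x₀) v, x₂)`,
  at the coefficient of `x₀^{-l-1} x₁^{-m-1} x₂^{-n-1}`; the sums are finite. -/
  jacobi : ∀ (u v w : V) (l m n : ℤ),
    ((∑ᶠ i : ℕ, ((-1) ^ i * Ring.choose l i : ℤ) •
        ((Y u)[[l + m - i]]) (((Y v)[[n + i]]) w)) -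
      ∑ᶠ i : ℕ, ((-1 : ℂ) ^ l) • (((-1) ^ i * Ring.choose l i : ℤ) •
        ((Y v)[[l + n - i]]) (((Y u)[[m + i]]) w))) =
    ∑ᶠ i : ℕ, (Ring.choose m i : ℤ) • ((Y (((Y u)[[l + i]]) v))[[m + n - i]]) w
  /-- The Virasoro relations for `L(n) = ω_{n+1}`. -/
  virasoro : ∀ (m n : ℤ) (v : V),
    ((Y omega)[[m + 1]]) (((Y omega)[[n + 1]]) v) -
        ((Y omega)[[n + 1]]) (((Y omega)[[m + 1]]) v) =
      ((m - n : ℤ) : ℂ) • ((Y omega)[[m + n + 1]]) v +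
        (if m + n = 0 then ((m : ℂ) ^ 3 - m) / 12 * centralCharge else 0) • v
  /-- `L(0) v = n v` for `v ∈ V_(n)`. -/
  L_zero : ∀ (n : ℤ), ∀ v ∈ grade n, ((Y omega)[[1]]) v = (n : ℂ) • v
  /-- `Y(L(-1) u, x) = d/dx Y(u, x)`. -/
  L_neg_one : ∀ (u v : V) (n : ℤ),
    ((Y (((Y omega)[[0]]) u))[[n]]) v = (-n : ℂ) • ((Y u)[[n - 1]]) v

namespace VertexOperatorAlgebra

variable {V : Type*} [AddCommGroup V] [Module ℂ V] (𝒱 : VertexOperatorAlgebra V)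

/-- The mode `uₙ`, the coefficient of `x^{-n-1}` in `Y(u, x)`. -/
def mode (u : V) (n : ℤ) : Module.End ℂ V := (𝒱.Y u)[[n]]

/-- The Virasoro operator `L(n) = ω_{n+1}`. -/
def L (n : ℤ) : Module.End ℂ V := 𝒱.mode 𝒱.omega (n + 1)

/-- The component in `V_(n)` of a vector. -/
def component (n : ℤ) (v : V) : V :=
  ((LinearEquiv.ofBijective (DirectSum.coeLinearMap 𝒱.grade) 𝒱.isInternal_grade).symm v) n

/-- `Res_x f(x) Y(u, x) v` for a formal Laurent series `f(x)`. -/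
def resY (f : LaurentSeries ℂ) (u v : V) : V :=
  ((HahnModule.of ℂ).symm (f • 𝒱.Y u v)).coeff (-1)

/-- The Laurent series `e^{2πix}`. -/
def expSeries : LaurentSeries ℂ :=
  HahnSeries.ofPowerSeries ℤ ℂ
    (PowerSeries.rescale (2 * Real.pi * Complex.I) (PowerSeries.exp ℂ))

/-- The Laurent series `2πi e^{2πix} / (e^{2πix} - 1)^n`. -/
def bulletKernel (n : ℕ) : LaurentSeries ℂ :=
  HahnSeries.C (2 * Real.pi * Complex.I) * expSeries / (expSeries - 1) ^ n

/-- The product `u • v = Res_x 2πi e^{2πix} / (e^{2πix} - 1) Y(u, x) v`. -/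
def bullet (u v : V) : V := 𝒱.resY (bulletKernel 1) u v

/-- The span of all `Res_x 2πi e^{2πix} / (e^{2πix} - 1)^n Y(u, x) v` with `n > 1`. -/
def OTilde : Submodule ℂ V :=
  Submodule.span ℂ {x | ∃ n : ℕ, 1 < n ∧ ∃ u v : V, x = 𝒱.resY (bulletKernel n) u v}

/-- The quotient space `Ã(V) = V / Õ(V)`. -/
abbrev ATilde : Type _ := V ⧸ 𝒱.OTilde

/-- The Laurent series `(1 + x)^k / x^n`, with `(1 + x)^k` expanded in nonnegative powers
of `x`. -/
def zhuKernel (k : ℤ) (n : ℕ) : LaurentSeries ℂ :=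
  (1 + HahnSeries.single 1 1) ^ k / (HahnSeries.single 1 1) ^ n

/-- Zhu's product: `u * v = Res_x (1 + x)^{wt u} / x Y(u, x) v` for homogeneous `u`, extended
linearly in `u`. -/
def zhuMul (u v : V) : V := ∑ᶠ k : ℤ, 𝒱.resY (zhuKernel k 1) (𝒱.component k u) v

/-- The span of all `Res_x (1 + x)^{wt u} / x² Y(u, x) v` with `u` homogeneous. -/
def zhuO : Submodule ℂ V :=
  Submodule.span ℂ {x | ∃ k : ℤ, ∃ u ∈ 𝒱.grade k, ∃ v : V, x = 𝒱.resY (zhuKernel k 2) u v}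

/-- The underlying space `A(V) = V / O(V)` of Zhu's algebra. -/
abbrev ZhuA : Type _ := V ⧸ 𝒱.zhuO

/-- The operator `L₊(A) = ∑_{j ≥ 1} A_j L(j)`; only finitely many `L(j) v` are nonzero. -/
def LPlus (v : V) : V := ∑ᶠ j : ℕ, logFlowCoeff (j + 1) • 𝒱.L (j + 1) v

/-- The operator `e^{-L₊(A)}`. The sum is finite on each vector, because every `L(j)`, `j ≥ 1`,
lowers weights by `j` and the weights of `V` are bounded below. -/
def expNegLPlus (v : V) : V :=
  ∑ᶠ k : ℕ, ((-1 : ℂ) ^ k / (k.factorial : ℂ)) • 𝒱.LPlus^[k] v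

/-- The operator `(2πi)^{L(0)}`, multiplication by `(2πi)^n` on `V_(n)`. -/
def twoPiIPowL0 (v : V) : V :=
  ∑ᶠ n : ℤ, ((2 * Real.pi * Complex.I : ℂ) ^ n) • 𝒱.component n v

/-- The operator `𝒰(1) = (2πi)^{L(0)} e^{-L₊(A)}`. -/
def U1 (v : V) : V := 𝒱.twoPiIPowL0 (𝒱.expNegLPlus v)

end VertexOperatorAlgebra

/-- The bilinear product `μ` is associative and `e` is a two-sided identity for it. -/
def IsUnitalAssociative {A : Type*} [AddCommGroup A] [Module ℂ A]
    (μ : A →ₗ[ℂ] A →ₗ[ℂ] A) (e : A) : Prop :=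
  (∀ a b c : A, μ (μ a b) c = μ a (μ b c)) ∧ ∀ a : A, μ e a = a ∧ μ a e = a

end

/-! Write κ = 2πi and b_n = κ e^{κx}/(e^{κx} - 1)^n. Associativity of `•` rests on the kernels. The
span of the b_n with n > 1 contains every divided derivative of b_1 of order at least one and is
stable under multiplication by each b_n, n ≥ 1, while b_1² = κ(b_2 + b_1). So in the commutator
formula for Res b_1 Y(u, x) and Res b_1 Y(v, x) applied to w, only κ (u_0 v) • w survives modulo
Õ(V). Since b_1(-x) = κ - b_1(x), skew symmetry modulo the image of L(-1), which lies in Õ(V), gives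
[u, v] = κ u_0 v. Hence u • (v • w) - v • (u • w) = [u, v] • w, and [u, ·] is a derivation because
u_0 is one; these two identities formally imply associativity
(`assoc_of_leftSymmetric_of_derivation`). The class of ω is central because ω_0 = L(-1).

The comparison with Zhu's algebra needs the change of variables y = e^{κx} - 1, under which b_n
becomes κ(1 + y)/y^n, together with the formula `uEnd_res` for 𝒰(1) Y(u, x) v. That formula comes
from a uniqueness argument. Let L[0] be the operator attached to the vector field (1 + y) log(1 + y)
d/dy. The defining identity of the A_j yields L[0] 𝒰(1) = 𝒰(1) L(0) (`vir_uEnd`), and L[0] obeys a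
Leibniz rule on weighted residues (`vir_wres`). For homogeneous u and v, both 𝒰(1)(u_n v) and its
expected value are therefore eigenvectors of L[0] with eigenvalue wt(u_n v), and they have the same
leading term. As L[0] is L(0) plus weight-lowering operators, their difference is zero
(`eq_zero_of_vir_eulerSeries`).

Consequently 𝒰(1), which is bijective because it is triangular for the weight filtration, carries
`•` to `*` and Õ(V) onto O(V). The algebra structure of A(V) is then transported from Ã(V). -/

noncomputable section

/-! ### Orders, derivatives and leading terms of Laurent series. -/

namespace LaurentSeries

/-- The coefficientwise algebra structure; it takes precedence over the one of
`HahnSeries.powerSeriesAlgebra`. -/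
local instance : Algebra ℂ (LaurentSeries ℂ) := HahnSeries.instAlgebra

/-- `f ∈ x^n ℂ⟦x⟧`. -/
def OrderGE (n : ℤ) (f : LaurentSeries ℂ) : Prop := ∀ m < n, f.coeff m = 0

theorem OrderGE.mono {n m : ℤ} {f : LaurentSeries ℂ} (h : OrderGE n f) (hm : m ≤ n) :
    OrderGE m f := fun k hk => h k (by omega)

theorem orderGE_order (f : LaurentSeries ℂ) : OrderGE f.order f :=
  fun _ hm => HahnSeries.coeff_eq_zero_of_lt_order hm

theorem OrderGE.add {n : ℤ} {f g : LaurentSeries ℂ} (hf : OrderGE n f) (hg : OrderGE n g) :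
    OrderGE n (f + g) := fun m hm => by simp [hf m hm, hg m hm]

theorem OrderGE.sub {n : ℤ} {f g : LaurentSeries ℂ} (hf : OrderGE n f) (hg : OrderGE n g) :
    OrderGE n (f - g) := fun m hm => by simp [hf m hm, hg m hm]

theorem OrderGE.smul {n : ℤ} {f : LaurentSeries ℂ} (c : ℂ) (hf : OrderGE n f) :
    OrderGE n (c • f) := fun m hm => by simp [hf m hm]

theorem orderGE_single (n : ℤ) (a : ℂ) : OrderGE n (HahnSeries.single n a) :=
  fun m hm => HahnSeries.coeff_single_of_ne (by omega)

theorem OrderGE.mul {n m : ℤ} {f g : LaurentSeries ℂ} (hf : OrderGE n f) (hg : OrderGE m g) :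
    OrderGE (n + m) (f * g) := by
  intro k hk
  rw [HahnSeries.coeff_mul]
  refine Finset.sum_eq_zero fun p hp => ?_
  rw [Finset.mem_antidiagonal] at hp
  rcases lt_or_ge p.1 n with h | h
  · rw [hf _ h, zero_mul]
  · rw [hg p.2 (by omega), mul_zero]

theorem orderGE_hasseDeriv {n : ℤ} (i : ℕ) {f : LaurentSeries ℂ} (hf : OrderGE n f) :
    OrderGE (n - i) (hasseDeriv ℂ i f) := by
  intro m hm
  rw [hasseDeriv_coeff, hf _ (by omega), smul_zero]

theorem orderGE_ofPowerSeries (p : PowerSeries ℂ) :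
    OrderGE 0 (HahnSeries.ofPowerSeries ℤ ℂ p) := by
  intro m hm
  rw [PowerSeries.coeff_coe, if_pos hm]

theorem orderGE_sub_single {n : ℤ} {f : LaurentSeries ℂ} (hf : OrderGE n f) :
    OrderGE (n + 1) (f - HahnSeries.single n (f.coeff n)) := by
  intro m hm
  rcases eq_or_ne m n with rfl | h
  · simp
  · simp [HahnSeries.coeff_single_of_ne h, hf m (by omega)]

/-- Induction on the order: a predicate that is additive, holds for the monomials in
`x^a ℂ⟦x⟧` and for all series of high order, holds for all series in `x^a ℂ⟦x⟧`. -/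
theorem induction_orderGE {P : LaurentSeries ℂ → Prop} (N a : ℤ)
    (hN : ∀ f, OrderGE N f → P f) (hadd : ∀ f g, P f → P g → P (f + g))
    (hs : ∀ n c, a ≤ n → P (HahnSeries.single n c)) (f : LaurentSeries ℂ) (hf : OrderGE a f) :
    P f := by
  have key : ∀ k : ℕ, ∀ f, OrderGE (N - k) f → OrderGE a f → P f := by
    intro k
    induction k with
    | zero => intro f hf _; exact hN f (by simpa using hf)
    | succ k ih =>
      intro f hf ha
      rcases lt_or_ge (N - (k + 1 : ℕ)) a with h | h
      · exact ih f (ha.mono (by push_cast at h; omega)) ha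
      · have h1 := ih _ ((orderGE_sub_single hf).mono (m := N - k) (by push_cast; omega))
          (ha.sub ((orderGE_single _ _).mono h))
        have := hadd _ _ h1 (hs (N - (k + 1 : ℕ)) (f.coeff (N - (k + 1 : ℕ))) h)
        rwa [sub_add_cancel] at this
  exact key (N - a).toNat f (hf.mono (by omega)) hf

theorem induction_order {P : LaurentSeries ℂ → Prop} (N : ℤ)
    (hN : ∀ f, OrderGE N f → P f) (hadd : ∀ f g, P f → P g → P (f + g))
    (hs : ∀ n c, P (HahnSeries.single n c)) (f : LaurentSeries ℂ) : P f :=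
  induction_orderGE N f.order hN hadd (fun n c _ => hs n c) f (orderGE_order f)

/-- A linear map that vanishes on the monomials and on all series of high order vanishes. -/
theorem linearMap_eq_zero {W : Type*} [AddCommGroup W] [Module ℂ W] (T : LaurentSeries ℂ →ₗ[ℂ] W)
    (N : ℤ) (hN : ∀ f, OrderGE N f → T f = 0) (hs : ∀ n, T (HahnSeries.single n 1) = 0)
    (f : LaurentSeries ℂ) : T f = 0 := by
  refine induction_order (P := fun f => T f = 0) N hN (fun f g hf hg => by simp [hf, hg])
    (fun n c => ?_) f
  have : HahnSeries.single n c = c • HahnSeries.single n (1 : ℂ) := by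
    ext m
    simp [HahnSeries.coeff_single]
  rw [this, map_smul, hs, smul_zero]

/-- A fixed coefficient of either side is linear in `f` and does not see terms of high order, so it
is enough to check monomials. -/
theorem derivative_mul (f g : LaurentSeries ℂ) :
    derivative ℂ (f * g) = f * derivative ℂ g + derivative ℂ f * g := by
  rw [← sub_eq_zero]
  ext n
  let T : LaurentSeries ℂ →ₗ[ℂ] ℂ :=
    { toFun f := (derivative ℂ (f * g) - (f * derivative ℂ g + derivative ℂ f * g)).coeff n
      map_add' a b := by
        simp only [add_mul, map_add, HahnSeries.coeff_sub, HahnSeries.coeff_add]; ring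
      map_smul' c a := by
        rw [← HahnSeries.C_mul_eq_smul, mul_assoc, HahnSeries.C_mul_eq_smul,
          HahnSeries.C_mul_eq_smul, map_smul, map_smul, ← HahnSeries.C_mul_eq_smul,
          ← HahnSeries.C_mul_eq_smul, ← HahnSeries.C_mul_eq_smul, mul_assoc, mul_assoc, ← mul_add,
          ← mul_sub, HahnSeries.C_mul_eq_smul, HahnSeries.coeff_smul, RingHom.id_apply] }
  -- From this order on, `f * g` has order at least `n + 2`; differentiation costs one, so the
  -- coefficient at `n` is not reached.
  refine linearMap_eq_zero T (n + 2 - g.order) (fun f hf => ?_) (fun a => ?_) f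
  · have hd : ∀ {m} {h : LaurentSeries ℂ}, OrderGE m h → OrderGE (m - 1) (derivative ℂ h) :=
      fun hh => orderGE_hasseDeriv 1 hh
    have h1 := hd (hf.mul (orderGE_order g))
    have h2 := hf.mul (hd (orderGE_order g))
    have h3 := (hd hf).mul (orderGE_order g)
    exact ((h1.mono (m := n + 1) (by omega)).sub
      ((h2.mono (by omega)).add (h3.mono (by omega)))) n (by omega)
  · have e' : ∀ (r : ℂ) (b : ℤ) (h : LaurentSeries ℂ), (HahnSeries.single b r * h).coeff (n + 1) =
        r * h.coeff (n - b + 1) := fun r b h => by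
      rw [HahnSeries.coeff_single_mul, show n + 1 - b = n - b + 1 by ring]
    have e : ∀ (r : ℂ) (b : ℤ) (h : LaurentSeries ℂ), (HahnSeries.single b r * h).coeff n =
        r * h.coeff (n - b) := fun r b h => HahnSeries.coeff_single_mul
    change (derivative ℂ _ - _ : LaurentSeries ℂ).coeff n = 0
    simp only [derivative_apply, HahnSeries.coeff_sub, HahnSeries.coeff_add, hasseDeriv_coeff,
      hasseDeriv_single, e, e', Nat.cast_one, Ring.choose_one_right, zsmul_eq_mul]
    rw [show n - (a - 1) = n - a + 1 by ring]
    push_cast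
    ring

/-- The derivative `d/dx` as a derivation of the field of Laurent series. -/
def deriv : Derivation ℂ (LaurentSeries ℂ) (LaurentSeries ℂ) :=
  Derivation.mk' (derivative ℂ) fun a b => by
    rw [derivative_mul, smul_eq_mul, smul_eq_mul, mul_comm b]

theorem deriv_apply (f : LaurentSeries ℂ) : deriv f = hasseDeriv ℂ 1 f := rfl

theorem hasseDeriv_one_eq (f : LaurentSeries ℂ) : hasseDeriv ℂ 1 f = deriv f := rfl

theorem coeff_deriv (f : LaurentSeries ℂ) (n : ℤ) :
    (deriv f).coeff n = (n + 1) * f.coeff (n + 1) := by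
  simp [deriv_apply]

theorem deriv_hasseDeriv (i : ℕ) (f : LaurentSeries ℂ) :
    deriv (hasseDeriv ℂ i f) = ((i + 1 : ℕ) : ℂ) • hasseDeriv ℂ (i + 1) f := by
  rw [deriv_apply, hasseDeriv_comp, Nat.choose_one_right, add_comm 1 i, Nat.cast_smul_eq_nsmul]

theorem deriv_C (a : ℂ) : deriv (HahnSeries.C a) = 0 := by
  rw [HahnSeries.C_eq_algebraMap]; exact deriv.map_algebraMap a

theorem deriv_mul (f g : LaurentSeries ℂ) : deriv (f * g) = f * deriv g + deriv f * g :=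
  derivative_mul f g

theorem deriv_smul (c : ℂ) (f : LaurentSeries ℂ) : deriv (c • f) = c • deriv f :=
  map_smul (derivative ℂ) c f

theorem deriv_zpow (f : LaurentSeries ℂ) (n : ℤ) :
    deriv (f ^ n) = HahnSeries.C (n : ℂ) * f ^ (n - 1) * deriv f := by
  rw [Derivation.leibniz_zpow, zsmul_eq_mul, smul_eq_mul, map_intCast, mul_assoc]

theorem deriv_ofPowerSeries (p : PowerSeries ℂ) :
    deriv (HahnSeries.ofPowerSeries ℤ ℂ p) =
      HahnSeries.ofPowerSeries ℤ ℂ (PowerSeries.derivative ℂ p) := by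
  ext n
  rw [coeff_deriv, PowerSeries.coeff_coe, PowerSeries.coeff_coe]
  rcases lt_or_ge n 0 with h | h
  · rw [if_pos h]
    rcases eq_or_ne n (-1) with rfl | h'
    · simp
    · rw [if_pos (by omega), mul_zero]
  · lift n to ℕ using h
    rw [if_neg (by omega), if_neg (by omega), PowerSeries.coeff_derivative]
    simp only [Int.natAbs_natCast, show ((n : ℤ) + 1).natAbs = n + 1 by omega]
    push_cast
    ring

/-- `f = x^n (1 + O(x))`. -/
def Monic (n : ℤ) (f : LaurentSeries ℂ) : Prop := OrderGE n f ∧ f.coeff n = 1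

theorem Monic.ne_zero {n : ℤ} {f : LaurentSeries ℂ} (h : Monic n f) : f ≠ 0 := by
  rintro rfl
  simpa using h.2

theorem monic_iff {n : ℤ} {f : LaurentSeries ℂ} :
    Monic n f ↔ f.order = n ∧ f.leadingCoeff = 1 := by
  constructor
  · intro h
    have h0 := h.ne_zero
    have : f.order = n := by
      apply le_antisymm (HahnSeries.order_le_of_coeff_ne_zero (by rw [h.2]; exact one_ne_zero))
      by_contra! hlt
      have := h.1 _ hlt
      rw [HahnSeries.coeff_order_eq_zero] at this
      exact h0 this
    exact ⟨this, by rw [HahnSeries.leadingCoeff_eq, this, h.2]⟩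
  · rintro ⟨rfl, h⟩
    exact ⟨orderGE_order f, by rwa [HahnSeries.leadingCoeff_eq] at h⟩

theorem monic_one : Monic 0 1 :=
  ⟨fun m hm => by rw [HahnSeries.coeff_one, if_neg (by omega)], by simp⟩

theorem Monic.mul {n m : ℤ} {f g : LaurentSeries ℂ} (hf : Monic n f) (hg : Monic m g) :
    Monic (n + m) (f * g) := by
  have h1 := hf.ne_zero
  have h2 := hg.ne_zero
  rw [monic_iff] at *
  rw [HahnSeries.order_mul h1 h2, HahnSeries.leadingCoeff_mul, hf.1, hf.2, hg.1, hg.2]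
  simp

theorem Monic.inv {n : ℤ} {f : LaurentSeries ℂ} (hf : Monic n f) : Monic (-n) f⁻¹ := by
  have h1 := hf.ne_zero
  have e : f * f⁻¹ = 1 := mul_inv_cancel₀ h1
  have h2 := HahnSeries.order_mul h1 (inv_ne_zero h1)
  have h3 := HahnSeries.leadingCoeff_mul f f⁻¹
  rw [e] at h2 h3
  rw [monic_iff] at *
  rw [HahnSeries.order_one] at h2
  rw [HahnSeries.leadingCoeff_one, hf.2, one_mul] at h3
  exact ⟨by omega, h3.symm⟩

theorem Monic.pow {n : ℤ} {f : LaurentSeries ℂ} (hf : Monic n f) (k : ℕ) :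
    Monic (k * n) (f ^ k) := by
  induction k with
  | zero => simpa using monic_one
  | succ k ih =>
    rw [pow_succ]
    convert ih.mul hf using 1
    push_cast
    ring

theorem Monic.zpow {n : ℤ} {f : LaurentSeries ℂ} (hf : Monic n f) (k : ℤ) :
    Monic (k * n) (f ^ k) := by
  cases k with
  | ofNat k => simpa using hf.pow k
  | negSucc k =>
    rw [zpow_negSucc]
    convert (hf.pow (k + 1)).inv using 1
    rw [Int.negSucc_eq]
    push_cast
    ring

end LaurentSeries

namespace VertexOperatorAlgebra

open LaurentSeries

variable {V : Type*} [AddCommGroup V] [Module ℂ V] (𝒱 : VertexOperatorAlgebra V)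

/-! ### Residues and modes -/

theorem coeff_smul_smul (c : ℂ) (f : LaurentSeries ℂ) (y : HahnModule ℤ ℂ V) (a : ℤ) :
    ((HahnModule.of ℂ).symm ((c • f) • y)).coeff a =
      c • ((HahnModule.of ℂ).symm (f • y)).coeff a := by
  rw [← HahnSeries.single_zero_mul_eq_smul]
  exact (congrArg (fun z => ((HahnModule.of ℂ).symm z).coeff a)
    (mul_smul (HahnSeries.single 0 c) f y)).trans HahnModule.coeff_single_zero_smul

theorem coeff_smul_smul_right (c : ℂ) (f : LaurentSeries ℂ) (y : HahnModule ℤ ℂ V) (a : ℤ) :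
    ((HahnModule.of ℂ).symm (f • (c • y))).coeff a =
      c • ((HahnModule.of ℂ).symm (f • y)).coeff a := by
  have h : c • y = HahnSeries.single (0 : ℤ) c • y :=
    (HahnModule.single_zero_smul_eq_smul ℤ).symm
  rw [← coeff_smul_smul, h, ← HahnSeries.single_zero_mul_eq_smul, mul_comm]
  exact congrArg (fun z => ((HahnModule.of ℂ).symm z).coeff a)
    (mul_smul f (HahnSeries.single 0 c) y).symm

/-- `Res_x f(x) Y(u, x) v` as a trilinear map. -/
def res : LaurentSeries ℂ →ₗ[ℂ] V →ₗ[ℂ] V →ₗ[ℂ] V where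
  toFun f := LinearMap.mk₂ ℂ (fun u v => 𝒱.resY f u v)
    (fun u u' v => by simp [resY])
    (fun c u v => by
      simp only [resY, map_smul, LinearMap.smul_apply]
      exact coeff_smul_smul_right c f _ _)
    (fun u v v' => by simp [resY])
    (fun c u v => by
      simp only [resY, map_smul]
      exact coeff_smul_smul_right c f _ _)
  map_add' f g := by
    ext u v
    simp [resY, add_smul]
  map_smul' c f := by
    ext u v
    simp only [LinearMap.mk₂_apply, LinearMap.smul_apply, RingHom.id_apply, resY]
    exact coeff_smul_smul c f _ _

theorem resY_eq_res (f : LaurentSeries ℂ) (u v : V) : 𝒱.resY f u v = 𝒱.res f u v := rfl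

theorem mode_eq_coeff (u v : V) (n : ℤ) :
    𝒱.mode u n v = ((HahnModule.of ℂ).symm (𝒱.Y u v)).coeff (-n - 1) := rfl

theorem res_single (n : ℤ) (c : ℂ) (u v : V) :
    𝒱.res (HahnSeries.single n c) u v = c • 𝒱.mode u n v := by
  rw [← resY_eq_res, resY, mode_eq_coeff]
  have := HahnModule.coeff_single_smul_vadd (r := c) (x := 𝒱.Y u v) (a := -n - 1) (b := n)
  rwa [vadd_eq_add, show n + (-n - 1) = -1 by ring] at this

theorem mode_eq_res (u v : V) (n : ℤ) :
    𝒱.mode u n v = 𝒱.res (HahnSeries.single n 1) u v := by rw [res_single, one_smul]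

theorem mode_add (u u' : V) (n : ℤ) : 𝒱.mode (u + u') n = 𝒱.mode u n + 𝒱.mode u' n := by
  simp [mode]

theorem mode_smul (c : ℂ) (u : V) (n : ℤ) : 𝒱.mode (c • u) n = c • 𝒱.mode u n := by
  simp [mode]

theorem mode_zero_left (n : ℤ) : 𝒱.mode 0 n = 0 := by
  simp [mode]

/-- This is the lower truncation Y(u, x) v ∈ V((x)). It provides the high-order case of
`induction_order`, so that identities between residues reduce to identities between modes. -/
theorem exists_res_eq_zero (u v : V) :
    ∃ N : ℤ, ∀ f, OrderGE N f → 𝒱.res f u v = 0 := by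
  refine ⟨-((HahnModule.of ℂ).symm (𝒱.Y u v)).order, fun f hf => ?_⟩
  rw [← resY_eq_res, resY, HahnModule.coeff_smul]
  refine Finset.sum_eq_zero fun p hp => ?_
  obtain ⟨h1, h2, h3⟩ := (Finset.mem_vaddAntidiagonal _ _).1 hp
  rw [vadd_eq_add] at h3
  exfalso
  have h4 : -((HahnModule.of ℂ).symm (𝒱.Y u v)).order ≤ p.1 := by
    by_contra! h
    exact h1 (hf _ h)
  have h5 : ((HahnModule.of ℂ).symm (𝒱.Y u v)).order ≤ p.2 :=
    HahnSeries.order_le_of_coeff_ne_zero h2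
  omega

theorem exists_res_eq_zero_of_lt (K : ℕ) (u : ℕ → V) (v : V) :
    ∃ N : ℤ, ∀ i < K, ∀ f, OrderGE N f → 𝒱.res f (u i) v = 0 := by
  induction K with
  | zero => exact ⟨0, fun i hi => absurd hi (Nat.not_lt_zero i)⟩
  | succ K ih =>
    obtain ⟨N, hN⟩ := ih
    obtain ⟨M, hM⟩ := 𝒱.exists_res_eq_zero (u K) v
    refine ⟨max N M, fun i hi f hf => ?_⟩
    rcases Nat.lt_succ_iff_lt_or_eq.1 hi with h | rfl
    · exact hN i h f (hf.mono (le_max_left _ _))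
    · exact hM f (hf.mono (le_max_right _ _))

theorem exists_mode_eq_zero (u v : V) :
    ∃ K : ℕ, ∀ n : ℤ, K ≤ n → 𝒱.mode u n v = 0 := by
  obtain ⟨N, hN⟩ := 𝒱.exists_res_eq_zero u v
  refine ⟨N.toNat, fun n hn => ?_⟩
  rw [mode_eq_res]
  exact hN _ ((orderGE_single n 1).mono (by omega))

/-- This is the Jacobi identity at l = 0: the binomials of 0 kill all but the first term of each sum
on the left. -/
theorem mode_commutator (u v w : V) (m n : ℤ) (K : ℕ) (hK : ∀ i : ℕ, K ≤ i → 𝒱.mode u i v = 0) :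
    𝒱.mode u m (𝒱.mode v n w) - 𝒱.mode v n (𝒱.mode u m w) =
      ∑ i ∈ Finset.range K, (Ring.choose m i : ℤ) • 𝒱.mode (𝒱.mode u i v) (m + n - i) w := by
  have h := 𝒱.jacobi u v w 0 m n
  rw [finsum_eq_single _ 0, finsum_eq_single _ 0,
    finsum_eq_sum_of_support_subset (s := Finset.range K)] at h
  · simpa [mode] using h
  · intro i hi
    rw [Function.mem_support] at hi
    rw [Finset.coe_range, Set.mem_Iio]
    by_contra! hlt
    apply hi
    have := hK i hlt
    rw [mode] at this
    rw [zero_add, this]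
    simp
  · intro i hi
    rw [Ring.choose_zero_pos _ (Nat.pos_of_ne_zero hi)]
    simp
  · intro i hi
    rw [Ring.choose_zero_pos _ (Nat.pos_of_ne_zero hi)]
    simp

/-- The commutator formula
`[Res f(x) Y(u, x), Res g(x) Y(v, x)] = ∑ᵢ Res (f^{(i)}(x) / i!) g(x) Y(uᵢ v, x)`. -/
theorem res_commutator (f g : LaurentSeries ℂ) (u v w : V) (K : ℕ)
    (hK : ∀ i : ℕ, K ≤ i → 𝒱.mode u i v = 0) :
    𝒱.res f u (𝒱.res g v w) - 𝒱.res g v (𝒱.res f u w) =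
      ∑ i ∈ Finset.range K, 𝒱.res (hasseDeriv ℂ i f * g) (𝒱.mode u i v) w := by
  obtain ⟨N₀, hN₀⟩ := 𝒱.exists_res_eq_zero_of_lt K (fun i => 𝒱.mode u i v) w
  obtain ⟨N₁, hN₁⟩ := 𝒱.exists_res_eq_zero u (𝒱.res g v w)
  obtain ⟨N₂, hN₂⟩ := 𝒱.exists_res_eq_zero u w
  refine induction_order (P := fun f => 𝒱.res f u (𝒱.res g v w) - 𝒱.res g v (𝒱.res f u w) =
      ∑ i ∈ Finset.range K, 𝒱.res (hasseDeriv ℂ i f * g) (𝒱.mode u i v) w)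
    (max (max N₁ N₂) (N₀ + K - g.order)) (fun f hf => ?_) (fun f f' h h' => ?_)
    (fun m c => ?_) f
  · rw [hN₁ f (hf.mono (by omega)), hN₂ f (hf.mono (by omega)), map_zero, sub_zero]
    refine (Finset.sum_eq_zero fun i hi => ?_).symm
    rw [Finset.mem_range] at hi
    exact hN₀ i hi _ (((orderGE_hasseDeriv i hf).mul (orderGE_order g)).mono (by omega))
  · simp only [map_add, LinearMap.add_apply, add_mul, Finset.sum_add_distrib]
    rw [← h, ← h']
    abel
  obtain ⟨N₃, hN₃⟩ := 𝒱.exists_res_eq_zero v w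
  obtain ⟨N₄, hN₄⟩ := 𝒱.exists_res_eq_zero v (𝒱.res (HahnSeries.single m c) u w)
  refine induction_order (P := fun g => 𝒱.res (HahnSeries.single m c) u (𝒱.res g v w) -
      𝒱.res g v (𝒱.res (HahnSeries.single m c) u w) =
      ∑ i ∈ Finset.range K, 𝒱.res (hasseDeriv ℂ i (HahnSeries.single m c) * g) (𝒱.mode u i v) w)
    (max (max N₃ N₄) (N₀ + K - m)) (fun g hg => ?_) (fun g g' h h' => ?_)
    (fun n d => ?_) g
  · rw [hN₃ g (hg.mono (by omega)), hN₄ g (hg.mono (by omega)), map_zero, sub_zero]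
    refine (Finset.sum_eq_zero fun i hi => ?_).symm
    rw [Finset.mem_range] at hi
    exact hN₀ i hi _ (((orderGE_hasseDeriv i (orderGE_single m c)).mul hg).mono (by omega))
  · simp only [map_add, LinearMap.add_apply, mul_add, Finset.sum_add_distrib]
    rw [← h, ← h']
    abel
  · simp only [res_single, map_smul, hasseDeriv_single, HahnSeries.single_mul_single]
    rw [smul_comm d c, ← smul_sub, ← smul_sub, mode_commutator 𝒱 u v w m n K hK,
      Finset.smul_sum, Finset.smul_sum]
    refine Finset.sum_congr rfl fun i _ => ?_
    rw [show m - i + n = m + n - i by ring, zsmul_eq_mul, ← Int.cast_smul_eq_zsmul ℂ, smul_smul,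
      smul_smul]
    congr 1
    ring

theorem L_neg_one_eq (u : V) : 𝒱.L (-1) u = 𝒱.mode 𝒱.omega 0 u := rfl

theorem L_zero_eq (u : V) : 𝒱.L 0 u = 𝒱.mode 𝒱.omega 1 u := rfl

/-- `Res f(x) Y(L(-1) u, x) = -Res f'(x) Y(u, x)`. -/
theorem res_L_neg_one (f : LaurentSeries ℂ) (u v : V) :
    𝒱.res f (𝒱.L (-1) u) v = -𝒱.res (LaurentSeries.deriv f) u v := by
  obtain ⟨N₁, hN₁⟩ := 𝒱.exists_res_eq_zero (𝒱.L (-1) u) v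
  obtain ⟨N₂, hN₂⟩ := 𝒱.exists_res_eq_zero u v
  refine induction_order
    (P := fun f => 𝒱.res f (𝒱.L (-1) u) v = -𝒱.res (LaurentSeries.deriv f) u v)
    (max N₁ (N₂ + 1)) (fun f hf => ?_) (fun f g h h' => ?_) (fun n c => ?_) f
  · rw [hN₁ f (hf.mono (by omega)), LaurentSeries.deriv_apply,
      hN₂ _ ((orderGE_hasseDeriv 1 hf).mono (by omega)), neg_zero]
  · rw [map_add, LinearMap.add_apply, LinearMap.add_apply, h, h', map_add, map_add,
      LinearMap.add_apply, LinearMap.add_apply, neg_add]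
  · rw [LaurentSeries.deriv_apply, hasseDeriv_single, res_single, res_single]
    have : 𝒱.mode (𝒱.L (-1) u) n v = (-n : ℂ) • 𝒱.mode u (n - 1) v := 𝒱.L_neg_one u v n
    rw [this, Ring.choose_one_right, zsmul_eq_mul, smul_smul, ← neg_smul]
    congr 1
    ring

/-! ### Skew symmetry modulo the image of `L(-1)` -/

theorem mode_vacuum (n : ℤ) (v : V) :
    𝒱.mode 𝒱.vacuum n v = if n = -1 then v else 0 := 𝒱.vacuum_mode n v

theorem mode_neg_one_vacuum (v : V) : 𝒱.mode v (-1) 𝒱.vacuum = v := (𝒱.creation v).1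

theorem mode_vacuum_eq_zero (v : V) (n : ℤ) (hn : 0 ≤ n) : 𝒱.mode v n 𝒱.vacuum = 0 :=
  (𝒱.creation v).2 n hn

/-- By the derivative property w_{-2} 𝟏 = L(-1) w, and each further step down rewrites the vector as
a nonzero multiple of (L(-1) w)_{-1-i} 𝟏. -/
theorem mode_vacuum_mem_range (w : V) (i : ℕ) (hi : 1 ≤ i) :
    𝒱.mode w (-1 - i) 𝒱.vacuum ∈ LinearMap.range (𝒱.L (-1)) := by
  have h0 : ∀ x : V, 𝒱.mode (𝒱.L (-1) x) (-1) 𝒱.vacuum = 𝒱.L (-1) x := fun x =>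
    𝒱.mode_neg_one_vacuum _
  have h1 : ∀ (x : V) (n : ℤ), 𝒱.mode (𝒱.L (-1) x) n 𝒱.vacuum =
      (-n : ℂ) • 𝒱.mode x (n - 1) 𝒱.vacuum := fun x n => 𝒱.L_neg_one x _ n
  induction i, hi using Nat.le_induction generalizing w with
  | base =>
    refine ⟨w, ?_⟩
    rw [← h0, h1]
    norm_num
  | succ i hi ih =>
    have h2 := ih (𝒱.L (-1) w)
    rw [h1] at h2
    have hc : (-((-1 - i : ℤ) : ℂ)) ≠ 0 := by
      rw [neg_ne_zero, Int.cast_ne_zero]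
      omega
    rw [Submodule.smul_mem_iff _ hc] at h2
    convert h2 using 2
    push_cast
    congr 1
    ring

/-- Skew symmetry: `v_n u ≡ (-1)^{n+1} u_n v` modulo the image of `L(-1)`. -/
theorem mode_skew (u v : V) (n : ℤ) :
    𝒱.mode v n u + (-1 : ℂ) ^ n • 𝒱.mode u n v ∈ LinearMap.range (𝒱.L (-1)) := by
  -- On the vacuum, creation kills the first sum and leaves only v_n u, up to sign, in the second.
  -- On the right the term i = 0 is u_n v, and the terms i ≥ 1 are covered by
  -- `mode_vacuum_mem_range`.
  have h := 𝒱.jacobi u v 𝒱.vacuum n (-1) 0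
  obtain ⟨K, hK⟩ := 𝒱.exists_mode_eq_zero u v
  have hsub : (Function.support fun i : ℕ => (Ring.choose (-1 : ℤ) i : ℤ) •
      ((𝒱.Y (((𝒱.Y u)[[n + i]]) v))[[-1 + 0 - i]]) 𝒱.vacuum) ⊆
      Finset.range ((K - n).toNat + 1) := by
    intro i hi
    rw [Function.mem_support] at hi
    rw [Finset.coe_range, Set.mem_Iio]
    by_contra! hlt
    apply hi
    have : ((𝒱.Y u)[[n + i]]) v = 0 := hK _ (by omega)
    rw [this]
    simp
  rw [finsum_eq_zero_of_forall_eq_zero, finsum_eq_single _ 0,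
    finsum_eq_sum_of_support_subset _ hsub, Finset.sum_range_succ'] at h
  · have e : 𝒱.mode v n u + (-1 : ℂ) ^ n • 𝒱.mode u n v =
        -((-1 : ℂ) ^ n) • ∑ i ∈ Finset.range (K - n).toNat, (Ring.choose (-1 : ℤ) (i + 1) : ℤ) •
          𝒱.mode (𝒱.mode u (n + (i + 1 : ℕ)) v) (-1 - (i + 1 : ℕ)) 𝒱.vacuum := by
      have h1 : ∀ x : V, ((𝒱.Y x)[[(-1)]]) 𝒱.vacuum = x := fun x => (𝒱.creation x).1
      have h2 : (-1 : ℂ) ^ n * (-1 : ℂ) ^ n = 1 := by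
        rw [← mul_zpow]; norm_num
      simp only [Ring.choose_zero_right, Nat.cast_zero, add_zero, sub_zero, pow_zero, mul_one,
        one_smul, h1, zero_sub] at h
      simp only [mode]
      rw [← sub_eq_iff_eq_add] at h
      rw [← h, smul_sub, smul_neg, smul_smul, neg_mul, h2, neg_smul, neg_smul, one_smul]
      abel
    rw [e]
    refine Submodule.smul_mem _ _ (Submodule.sum_mem _ fun i _ => ?_)
    exact Submodule.smul_of_tower_mem _ _ (𝒱.mode_vacuum_mem_range _ _ (by omega))
  · intro i hi
    have : ((𝒱.Y u)[[-1 + i]]) 𝒱.vacuum = 0 := 𝒱.mode_vacuum_eq_zero u _ (by omega)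
    rw [this]
    simp
  · intro i
    have : ((𝒱.Y v)[[0 + i]]) 𝒱.vacuum = 0 := 𝒱.mode_vacuum_eq_zero v _ (by omega)
    rw [this]
    simp

end VertexOperatorAlgebra

local notation "κ" => (2 * (Real.pi : ℂ) * Complex.I)

/-! ### Reflection of Laurent series. -/

namespace LaurentSeries

/-- The substitution `x ↦ -x`. -/
def reflect : LaurentSeries ℂ →ₗ[ℂ] LaurentSeries ℂ where
  toFun f := HahnSeries.ofSuppBddBelow (fun n => (-1 : ℂ) ^ n * f.coeff n) <| by
    refine ⟨f.order, fun n hn => ?_⟩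
    contrapose! hn
    rw [Function.notMem_support, HahnSeries.coeff_eq_zero_of_lt_order hn, mul_zero]
  map_add' f g := by
    ext n
    exact mul_add _ _ _
  map_smul' c f := by
    ext n
    exact mul_left_comm _ _ _

theorem coeff_reflect (f : LaurentSeries ℂ) (n : ℤ) :
    (reflect f).coeff n = (-1 : ℂ) ^ n * f.coeff n := rfl

theorem OrderGE.reflect {n : ℤ} {f : LaurentSeries ℂ} (hf : OrderGE n f) :
    OrderGE n (reflect f) := fun m hm => by rw [coeff_reflect, hf m hm, mul_zero]

theorem reflect_single (n : ℤ) (c : ℂ) :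
    reflect (HahnSeries.single n c) = HahnSeries.single n ((-1 : ℂ) ^ n * c) := by
  ext m
  rw [coeff_reflect]
  rcases eq_or_ne m n with rfl | h
  · simp
  · simp [HahnSeries.coeff_single_of_ne h]

theorem reflect_mul (f g : LaurentSeries ℂ) : reflect (f * g) = reflect f * reflect g := by
  ext n
  refine induction_order
    (P := fun f => (reflect (f * g)).coeff n = (reflect f * reflect g).coeff n)
    (n + 1 - g.order) (fun f hf => ?_) (fun a b ha hb => ?_) (fun m c => ?_) f
  · rw [(hf.mul (orderGE_order g)).reflect n (by omega),
      (hf.reflect.mul (orderGE_order g).reflect) n (by omega)]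
  · rw [add_mul, map_add, map_add, add_mul, HahnSeries.coeff_add, HahnSeries.coeff_add, ha, hb]
  · rw [reflect_single, coeff_reflect, HahnSeries.coeff_single_mul, HahnSeries.coeff_single_mul,
      coeff_reflect]
    have : (-1 : ℂ) ^ n = (-1) ^ m * (-1) ^ (n - m) := by
      rw [← zpow_add₀ (by norm_num)]
      congr 1
      ring
    rw [this]
    ring

theorem reflect_ofPowerSeries (p : PowerSeries ℂ) :
    reflect (HahnSeries.ofPowerSeries ℤ ℂ p) =
      HahnSeries.ofPowerSeries ℤ ℂ (PowerSeries.rescale (-1) p) := by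
  ext n
  rw [coeff_reflect, PowerSeries.coeff_coe, PowerSeries.coeff_coe]
  split_ifs with h
  · simp
  · lift n to ℕ using (not_lt.1 h)
    simp [PowerSeries.coeff_rescale]

end LaurentSeries

namespace VertexOperatorAlgebra

open LaurentSeries

/-! ### The kernels `2πi e^{2πix} / (e^{2πix} - 1)^n` -/

theorem twoPiI_ne_zero : κ ≠ 0 := Complex.two_pi_I_ne_zero

theorem coeff_expSeries_of_nonneg (n : ℕ) :
    expSeries.coeff n = κ ^ n / (n.factorial : ℂ) := by
  rw [expSeries, PowerSeries.coeff_coe, if_neg (by omega), PowerSeries.coeff_rescale,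
    Int.natAbs_natCast, PowerSeries.coeff_exp]
  simp [div_eq_mul_inv]

theorem monic_expSeries : Monic 0 expSeries := by
  refine ⟨orderGE_ofPowerSeries _, ?_⟩
  simpa using coeff_expSeries_of_nonneg 0

theorem monic_expSeries_sub_one : Monic 1 (HahnSeries.C κ⁻¹ * (expSeries - 1)) := by
  have h1 : (expSeries - 1).coeff 1 = κ := by
    have := coeff_expSeries_of_nonneg 1
    rw [HahnSeries.coeff_sub, HahnSeries.coeff_one, if_neg one_ne_zero]
    simpa using this
  refine ⟨fun m hm => ?_, ?_⟩
  · rw [HahnSeries.C_mul_eq_smul, HahnSeries.coeff_smul, HahnSeries.coeff_sub,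
      HahnSeries.coeff_one]
    rcases eq_or_ne m 0 with rfl | h
    · rw [if_pos rfl, monic_expSeries.2, sub_self, smul_zero]
    · rw [if_neg h, monic_expSeries.1 m (by omega), sub_self, smul_zero]
  · rw [HahnSeries.C_mul_eq_smul, HahnSeries.coeff_smul, h1, smul_eq_mul,
      inv_mul_cancel₀ twoPiI_ne_zero]

theorem expSeries_sub_one_ne_zero : expSeries - 1 ≠ 0 := fun h =>
  monic_expSeries_sub_one.ne_zero (by rw [h, mul_zero])

/-- The leading term x^{-1} is what makes the vacuum a two-sided identity for `•` on V itself. -/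
theorem monic_bulletKernel_one : Monic (-1) (bulletKernel 1) := by
  have h := monic_expSeries.mul monic_expSeries_sub_one.inv
  rw [zero_add] at h
  convert h using 1
  rw [bulletKernel, map_inv₀, pow_one]
  field_simp

theorem deriv_expSeries : LaurentSeries.deriv expSeries = HahnSeries.C κ * expSeries := by
  ext n
  rw [coeff_deriv, HahnSeries.C_mul_eq_smul, HahnSeries.coeff_smul]
  rcases lt_or_ge n 0 with h | h
  · rw [monic_expSeries.1 n h]
    rcases eq_or_ne n (-1) with rfl | h'
    · simp
    · rw [monic_expSeries.1 (n + 1) (by omega)]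
      simp
  · lift n to ℕ using h
    have := coeff_expSeries_of_nonneg (n + 1)
    push_cast at this
    rw [this, coeff_expSeries_of_nonneg, Nat.factorial_succ, smul_eq_mul]
    have h1 : (n.factorial : ℂ) ≠ 0 := Nat.cast_ne_zero.2 n.factorial_ne_zero
    have h2 : (n : ℂ) + 1 ≠ 0 := Nat.cast_add_one_ne_zero n
    push_cast
    field_simp
    ring

/-- Differentiating the denominator produces a second factor e^{κx}, and e^{κx} = (e^{κx} - 1) + 1
splits the result into two kernels. Conversely, the kernel of index n + 1 is recovered from that of
index n ≥ 1 and its derivative. -/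
theorem deriv_bulletKernel (n : ℕ) :
    LaurentSeries.deriv (bulletKernel n) =
      κ • bulletKernel n - (κ * n) • (bulletKernel n + bulletKernel (n + 1)) := by
  have e : bulletKernel n = HahnSeries.C κ * (expSeries * (expSeries - 1) ^ (-n : ℤ)) := by
    rw [bulletKernel, zpow_neg, zpow_natCast]
    ring
  have h := expSeries_sub_one_ne_zero
  have h0 : LaurentSeries.deriv (1 : LaurentSeries ℂ) = 0 := by
    simp
  rw [e, deriv_mul, deriv_C, deriv_mul, deriv_zpow, map_sub, h0, deriv_expSeries, bulletKernel,
    zpow_sub_one₀ h, zpow_neg, zpow_natCast, ← HahnSeries.C_mul_eq_smul,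
    ← HahnSeries.C_mul_eq_smul]
  push_cast
  rw [map_mul (HahnSeries.C : ℂ →+* LaurentSeries ℂ) κ, map_neg]
  generalize (HahnSeries.C κ : LaurentSeries ℂ) = c
  field_simp
  ring

theorem bulletKernel_mul (m n : ℕ) :
    bulletKernel (m + 1) * bulletKernel n =
      κ • (bulletKernel (m + n + 1) + bulletKernel (m + n)) := by
  have h := expSeries_sub_one_ne_zero
  rw [bulletKernel, bulletKernel, bulletKernel, bulletKernel, ← HahnSeries.C_mul_eq_smul]
  field_simp
  ring

/-- The span of the kernels `2πi e^{2πix} / (e^{2πix} - 1)^n` with `n > 1`. -/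
def kernelSpan : Submodule ℂ (LaurentSeries ℂ) :=
  Submodule.span ℂ {f | ∃ n : ℕ, 1 < n ∧ f = bulletKernel n}

theorem bulletKernel_mem {n : ℕ} (hn : 1 < n) : bulletKernel n ∈ kernelSpan :=
  Submodule.subset_span ⟨n, hn, rfl⟩

theorem deriv_bulletKernel_one :
    LaurentSeries.deriv (bulletKernel 1) = -κ • bulletKernel 2 := by
  rw [deriv_bulletKernel]
  simp only [Nat.cast_one, mul_one, smul_add]
  rw [sub_add_cancel_left, ← neg_smul]

theorem deriv_mem_kernelSpan {f : LaurentSeries ℂ} (hf : f ∈ kernelSpan) :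
    LaurentSeries.deriv f ∈ kernelSpan := by
  induction hf using Submodule.span_induction with
  | mem f hf =>
    obtain ⟨n, hn, rfl⟩ := hf
    rw [deriv_bulletKernel]
    exact sub_mem (Submodule.smul_mem _ _ (bulletKernel_mem hn)) (Submodule.smul_mem _ _
      (add_mem (bulletKernel_mem hn) (bulletKernel_mem (by omega))))
  | zero => rw [map_zero]; exact zero_mem _
  | add f g _ _ hf hg => rw [map_add]; exact add_mem hf hg
  | smul c f _ hf => rw [deriv_smul]; exact Submodule.smul_mem _ _ hf

/-- Together with `mul_bulletKernel_mem`, this puts all terms i ≥ 1 of the commutator formula into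
Õ(V). -/
theorem hasseDeriv_bulletKernel_mem (i : ℕ) :
    hasseDeriv ℂ (i + 1) (bulletKernel 1) ∈ kernelSpan := by
  induction i with
  | zero =>
    rw [zero_add, hasseDeriv_one_eq, deriv_bulletKernel_one]
    exact Submodule.smul_mem _ _ (bulletKernel_mem one_lt_two)
  | succ i ih =>
    have h := deriv_mem_kernelSpan ih
    rw [deriv_hasseDeriv] at h
    exact (Submodule.smul_mem_iff _ (Nat.cast_ne_zero.2 (by omega))).1 h

theorem mul_bulletKernel_mem {f : LaurentSeries ℂ} (hf : f ∈ kernelSpan) {n : ℕ} (hn : 1 ≤ n) :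
    f * bulletKernel n ∈ kernelSpan := by
  induction hf using Submodule.span_induction with
  | mem f hf =>
    obtain ⟨m, hm, rfl⟩ := hf
    obtain ⟨m, rfl⟩ : ∃ k, m = k + 1 := ⟨m - 1, by omega⟩
    rw [bulletKernel_mul]
    exact Submodule.smul_mem _ _
      (add_mem (bulletKernel_mem (by omega)) (bulletKernel_mem (by omega)))
  | zero => rw [zero_mul]; exact zero_mem _
  | add f g _ _ hf hg => rw [add_mul]; exact add_mem hf hg
  | smul c f _ hf =>
    rw [← HahnSeries.C_mul_eq_smul, mul_assoc, HahnSeries.C_mul_eq_smul]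
    exact Submodule.smul_mem _ _ hf

/-- The constant κ here is the origin of the term 2πi u_0 v in the commutator of `•`. -/
theorem reflect_bulletKernel_one :
    reflect (bulletKernel 1) = -(bulletKernel 1 - HahnSeries.C κ) := by
  have h1 : expSeries * reflect expSeries = 1 := by
    rw [expSeries, reflect_ofPowerSeries, ← map_mul]
    have h := PowerSeries.exp_mul_exp_neg_eq_one (A := ℂ)
    rw [PowerSeries.evalNegHom] at h
    have h' := congrArg (PowerSeries.rescale κ) h
    rw [map_mul, map_one] at h'
    have : PowerSeries.rescale (-1 : ℂ) (PowerSeries.rescale κ (PowerSeries.exp ℂ)) =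
        PowerSeries.rescale κ (PowerSeries.rescale (-1 : ℂ) (PowerSeries.exp ℂ)) := by
      rw [PowerSeries.rescale_rescale, PowerSeries.rescale_rescale, mul_comm]
    rw [this, h', map_one]
  have hC : reflect (HahnSeries.C κ) = HahnSeries.C κ := by
    have := reflect_single 0 κ
    simpa using this
  have hone : reflect 1 = 1 := by
    have := reflect_single 0 1
    simpa using this
  have h2 : bulletKernel 1 * (expSeries - 1) = HahnSeries.C κ * expSeries := by
    rw [bulletKernel, pow_one, div_mul_cancel₀ _ expSeries_sub_one_ne_zero]
  have h3 := congrArg reflect h2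
  rw [reflect_mul, reflect_mul, map_sub, hone, hC] at h3
  have h4 : (reflect (bulletKernel 1) + bulletKernel 1 - HahnSeries.C κ) * (expSeries - 1) = 0 := by
    -- Since e^{κx} e^{-κx} = 1, multiplying `h3` by -e^{κx} gives b_1(-x)(e^{κx} - 1) = -κ; adding
    -- `h2` gives (b_1(-x) + b_1(x))(e^{κx} - 1) = κ(e^{κx} - 1).
    linear_combination (-expSeries) * h3 + h2 + (reflect (bulletKernel 1) - HahnSeries.C κ) * h1
  have h5 := (mul_eq_zero.1 h4).resolve_right expSeries_sub_one_ne_zero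
  linear_combination h5

end VertexOperatorAlgebra

/-! ### Bilinear products: a criterion for associativity, and quotients. -/

/-- A product whose associator is symmetric in the first two arguments and whose commutators
`[a, ·]` are derivations is associative. -/
theorem assoc_of_leftSymmetric_of_derivation {A : Type*} [AddCommGroup A] [Module ℂ A]
    (μ : A →ₗ[ℂ] A →ₗ[ℂ] A)
    (hs : ∀ a b c, μ a (μ b c) - μ b (μ a c) = μ (μ a b - μ b a) c)
    (hd : ∀ a b c, μ a (μ b c) - μ (μ b c) a = μ (μ a b - μ b a) c + μ b (μ a c - μ c a))
    (a b c : A) : μ (μ a b) c = μ a (μ b c) := by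
  -- The derivation rule reads c(ab) - (ab)c = [c, a]b + a[c, b]. Expanding [c, a]b as c(ab) - a(cb)
  -- cancels everything except (ab)c = a(bc).
  have h := hd c a b
  rw [← hs, map_sub] at h
  rw [← sub_eq_zero] at h ⊢
  rw [← neg_eq_zero, ← h]
  abel

/-- The product on `A ⧸ W` induced by a product on `A` for which `W` is a two-sided ideal. -/
def quotientMul {A : Type*} [AddCommGroup A] [Module ℂ A] (W : Submodule ℂ A)
    (m : A →ₗ[ℂ] A →ₗ[ℂ] A) (hl : ∀ a, ∀ x ∈ W, m a x ∈ W) (hr : ∀ x ∈ W, ∀ a, m x a ∈ W) :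
    A ⧸ W →ₗ[ℂ] A ⧸ W →ₗ[ℂ] A ⧸ W :=
  W.liftQ
    { toFun := fun a => W.mapQ W (m a) (fun x hx => hl a x hx)
      map_add' := fun a b => by ext x; simp
      map_smul' := fun c a => by ext x; simp }
    fun x hx => by
      rw [LinearMap.mem_ker]
      ext a
      simpa using hr x hx a

namespace VertexOperatorAlgebra

open LaurentSeries

variable {V : Type*} [AddCommGroup V] [Module ℂ V] (𝒱 : VertexOperatorAlgebra V)

/-! ### The algebra `Ã(V)` -/

theorem bullet_eq_res (u v : V) : 𝒱.bullet u v = 𝒱.res (bulletKernel 1) u v := rfl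

theorem res_bulletKernel_mem_OTilde {n : ℕ} (hn : 1 < n) (u v : V) :
    𝒱.res (bulletKernel n) u v ∈ 𝒱.OTilde :=
  Submodule.subset_span ⟨n, hn, u, v, rfl⟩

theorem res_mem_OTilde {f : LaurentSeries ℂ} (hf : f ∈ kernelSpan) (u v : V) :
    𝒱.res f u v ∈ 𝒱.OTilde := by
  induction hf using Submodule.span_induction with
  | mem f hf =>
    obtain ⟨n, hn, rfl⟩ := hf
    exact 𝒱.res_bulletKernel_mem_OTilde hn u v
  | zero => simp
  | add f g _ _ hf hg => rw [map_add]; exact add_mem hf hg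
  | smul c f _ hf => rw [map_smul]; exact Submodule.smul_mem _ _ hf

theorem bullet_L_neg_one_mem (u v : V) : 𝒱.bullet (𝒱.L (-1) u) v ∈ 𝒱.OTilde := by
  rw [bullet_eq_res, res_L_neg_one, deriv_bulletKernel_one]
  exact neg_mem (𝒱.res_mem_OTilde
    (Submodule.smul_mem _ _ (bulletKernel_mem one_lt_two)) u v)

theorem res_vacuum_right {f : LaurentSeries ℂ} (hf : OrderGE 0 f) (u : V) :
    𝒱.res f u 𝒱.vacuum = 0 := by
  obtain ⟨N, hN⟩ := 𝒱.exists_res_eq_zero u 𝒱.vacuum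
  refine induction_orderGE (P := fun f => 𝒱.res f u 𝒱.vacuum = 0) N 0 hN
    (fun f g hf hg => ?_) (fun n c hn => ?_) f hf
  · rw [map_add, LinearMap.add_apply, LinearMap.add_apply, hf, hg, add_zero]
  · rw [res_single, mode_vacuum_eq_zero _ _ _ hn, smul_zero]

theorem bullet_vacuum (u : V) : 𝒱.bullet u 𝒱.vacuum = u := by
  have h := orderGE_sub_single monic_bulletKernel_one.1
  rw [monic_bulletKernel_one.2] at h
  have h' := 𝒱.res_vacuum_right h u
  rw [map_sub, LinearMap.sub_apply, LinearMap.sub_apply, res_single, one_smul,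
    mode_neg_one_vacuum, sub_eq_zero] at h'
  exact h'

theorem res_vacuum (f : LaurentSeries ℂ) (v : V) :
    𝒱.res f 𝒱.vacuum v = f.coeff (-1) • v := by
  obtain ⟨N, hN⟩ := 𝒱.exists_res_eq_zero 𝒱.vacuum v
  refine induction_order (P := fun f => 𝒱.res f 𝒱.vacuum v = f.coeff (-1) • v) (max N 0)
    (fun f hf => ?_) (fun f g hf hg => ?_) (fun n c => ?_) f
  · rw [hN f (hf.mono (by omega)), hf (-1) (by omega), zero_smul]
  · rw [map_add, LinearMap.add_apply, LinearMap.add_apply, hf, hg, HahnSeries.coeff_add, add_smul]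
  · rw [res_single, mode_vacuum]
    split_ifs with h
    · rw [h, HahnSeries.coeff_single_same]
    · rw [HahnSeries.coeff_single_of_ne (Ne.symm h), smul_zero, zero_smul]

theorem vacuum_bullet (v : V) : 𝒱.bullet 𝒱.vacuum v = v := by
  rw [bullet_eq_res, res_vacuum, monic_bulletKernel_one.2, one_smul]

/-- Indeed L(-1) u = (L(-1) u) • 𝟏, and moving L(-1) onto the kernel replaces b_1 by a multiple of
b_2. -/
theorem range_L_neg_one_le : LinearMap.range (𝒱.L (-1)) ≤ 𝒱.OTilde := by
  rintro _ ⟨u, rfl⟩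
  rw [← 𝒱.bullet_vacuum (𝒱.L (-1) u)]
  exact 𝒱.bullet_L_neg_one_mem _ _

/-- Skew symmetry: `Res f(x) Y(v, x) u ≡ -Res f(-x) Y(u, x) v` modulo the image of `L(-1)`. -/
theorem res_skew (f : LaurentSeries ℂ) (u v : V) :
    𝒱.res f v u + 𝒱.res (reflect f) u v ∈ LinearMap.range (𝒱.L (-1)) := by
  obtain ⟨N₁, hN₁⟩ := 𝒱.exists_res_eq_zero v u
  obtain ⟨N₂, hN₂⟩ := 𝒱.exists_res_eq_zero u v
  refine induction_order
    (P := fun f => 𝒱.res f v u + 𝒱.res (reflect f) u v ∈ LinearMap.range (𝒱.L (-1)))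
    (max N₁ N₂) (fun f hf => ?_) (fun f g hf hg => ?_) (fun n c => ?_) f
  · rw [hN₁ f (hf.mono (by omega)), hN₂ _ (hf.reflect.mono (by omega)), add_zero]
    exact zero_mem _
  · convert add_mem hf hg using 1
    simp only [map_add, LinearMap.add_apply]
    abel
  · rw [reflect_single, res_single, res_single, mul_comm, mul_smul, ← smul_add]
    exact Submodule.smul_mem _ _ (𝒱.mode_skew u v n)

theorem res_C (c : ℂ) (u v : V) : 𝒱.res (HahnSeries.C c) u v = c • 𝒱.mode u 0 v :=
  𝒱.res_single 0 c u v

theorem bullet_sub_bullet_mem (u v : V) :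
    𝒱.bullet u v - (𝒱.bullet v u + κ • 𝒱.mode u 0 v) ∈ 𝒱.OTilde := by
  have h := neg_mem (𝒱.range_L_neg_one_le (𝒱.res_skew (bulletKernel 1) u v))
  rw [reflect_bulletKernel_one, map_neg, map_sub, LinearMap.neg_apply, LinearMap.neg_apply,
    LinearMap.sub_apply, LinearMap.sub_apply, res_C] at h
  rw [bullet_eq_res, bullet_eq_res]
  convert h using 1
  abel

theorem bullet_sub_bullet_mem' (u v : V) :
    𝒱.bullet u v - (𝒱.bullet v u - κ • 𝒱.mode v 0 u) ∈ 𝒱.OTilde := by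
  have h := neg_mem (𝒱.bullet_sub_bullet_mem v u)
  convert h using 1
  abel

/-- The mode u_0 is the residue against the constant 1, whose higher divided derivatives vanish, so
only the term i = 0 of the commutator formula remains. Thus u_0 is a derivation of all residue
products at once. -/
theorem mode_zero_res (f : LaurentSeries ℂ) (u v w : V) :
    𝒱.mode u 0 (𝒱.res f v w) = 𝒱.res f (𝒱.mode u 0 v) w + 𝒱.res f v (𝒱.mode u 0 w) := by
  obtain ⟨K, hK⟩ := 𝒱.exists_mode_eq_zero u v
  have h := 𝒱.res_commutator (HahnSeries.single 0 1) f u v w (K + 1)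
    (fun i hi => hK i (by omega))
  rw [Finset.sum_range_succ', Finset.sum_eq_zero, hasseDeriv_zero] at h
  · rw [res_single, res_single, one_smul, one_smul, sub_eq_iff_eq_add] at h
    rw [h]
    simp
  · intro i _
    rw [hasseDeriv_single, Ring.choose_zero_pos _ (Nat.succ_pos i)]
    simp

theorem mode_zero_mem_OTilde (u : V) {x : V} (hx : x ∈ 𝒱.OTilde) : 𝒱.mode u 0 x ∈ 𝒱.OTilde := by
  induction hx using Submodule.span_induction with
  | mem x hx =>
    obtain ⟨n, hn, v, w, rfl⟩ := hx
    rw [resY_eq_res, mode_zero_res]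
    exact add_mem (𝒱.res_bulletKernel_mem_OTilde hn _ _) (𝒱.res_bulletKernel_mem_OTilde hn _ _)
  | zero => simp
  | add x y _ _ hx hy => rw [map_add]; exact add_mem hx hy
  | smul c x _ hx => rw [map_smul]; exact Submodule.smul_mem _ _ hx

/-- `[Res f₁ Y(u, x), Res fₙ Y(v, x)] ≡ Res f₁ fₙ Y(u₀ v, x)` modulo `Õ(V)`, where
`fₙ = bulletKernel n`. -/
theorem commutator_bulletKernel_mem (u v w : V) {n : ℕ} (hn : 1 ≤ n) :
    𝒱.res (bulletKernel 1) u (𝒱.res (bulletKernel n) v w) -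
      𝒱.res (bulletKernel n) v (𝒱.res (bulletKernel 1) u w) -
      𝒱.res (bulletKernel 1 * bulletKernel n) (𝒱.mode u 0 v) w ∈ 𝒱.OTilde := by
  obtain ⟨K, hK⟩ := 𝒱.exists_mode_eq_zero u v
  rw [𝒱.res_commutator _ _ u v w (K + 1) (fun i hi => hK i (by omega)),
    Finset.sum_range_succ', hasseDeriv_zero, LinearMap.id_apply, Nat.cast_zero,
    add_sub_cancel_right]
  exact Submodule.sum_mem _ fun i _ =>
    𝒱.res_mem_OTilde (mul_bulletKernel_mem (hasseDeriv_bulletKernel_mem i) hn) _ _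

/-- Commuting Res b_1 Y(u, x) past Res b_n Y(v, x) with n > 1 costs only residues against b_1 b_n
and kernels of the same kind, all in the span of the b_m with m > 1. -/
theorem bullet_mem_OTilde_right (u : V) {x : V} (hx : x ∈ 𝒱.OTilde) :
    𝒱.res (bulletKernel 1) u x ∈ 𝒱.OTilde := by
  induction hx using Submodule.span_induction with
  | mem x hx =>
    obtain ⟨n, hn, v, w, rfl⟩ := hx
    rw [resY_eq_res]
    have h1 := 𝒱.commutator_bulletKernel_mem u v w hn.le
    have h2 : 𝒱.res (bulletKernel 1 * bulletKernel n) (𝒱.mode u 0 v) w ∈ 𝒱.OTilde := by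
      rw [mul_comm]
      exact 𝒱.res_mem_OTilde (mul_bulletKernel_mem (bulletKernel_mem hn) le_rfl) _ _
    have h3 := 𝒱.res_bulletKernel_mem_OTilde hn v (𝒱.res (bulletKernel 1) u w)
    convert add_mem (add_mem h1 h2) h3 using 1
    abel
  | zero => simp
  | add x y _ _ hx hy => rw [map_add]; exact add_mem hx hy
  | smul c x _ hx => rw [map_smul]; exact Submodule.smul_mem _ _ hx

/-- Reduced to the other side by the commutator relation, since v_0 preserves Õ(V). -/
theorem bullet_mem_OTilde_left {x : V} (hx : x ∈ 𝒱.OTilde) (v : V) :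
    𝒱.res (bulletKernel 1) x v ∈ 𝒱.OTilde := by
  have h1 := 𝒱.bullet_sub_bullet_mem' x v
  have h2 := 𝒱.bullet_mem_OTilde_right v hx
  have h3 := Submodule.smul_mem _ κ (𝒱.mode_zero_mem_OTilde v hx)
  rw [← bullet_eq_res] at h2 ⊢
  convert sub_mem (add_mem h1 h2) h3 using 1
  abel

/-- The product on `Ã(V)` induced by `•`. -/
def mulTilde : 𝒱.ATilde →ₗ[ℂ] 𝒱.ATilde →ₗ[ℂ] 𝒱.ATilde :=
  quotientMul 𝒱.OTilde (𝒱.res (bulletKernel 1)) (fun u _ hx => 𝒱.bullet_mem_OTilde_right u hx)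
    (fun _ hx v => 𝒱.bullet_mem_OTilde_left hx v)

theorem mulTilde_mkQ (u v : V) :
    𝒱.mulTilde (𝒱.OTilde.mkQ u) (𝒱.OTilde.mkQ v) = 𝒱.OTilde.mkQ (𝒱.bullet u v) := rfl

theorem mulTilde_commutator (u v : V) :
    𝒱.mulTilde (𝒱.OTilde.mkQ u) (𝒱.OTilde.mkQ v) - 𝒱.mulTilde (𝒱.OTilde.mkQ v) (𝒱.OTilde.mkQ u) =
      𝒱.OTilde.mkQ (κ • 𝒱.mode u 0 v) := by
  rw [mulTilde_mkQ, mulTilde_mkQ, ← map_sub, ← sub_eq_zero, ← map_sub]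
  have h := 𝒱.bullet_sub_bullet_mem u v
  rw [← sub_sub] at h
  exact (Submodule.Quotient.mk_eq_zero _).2 h

theorem isUnitalAssociative_mulTilde :
    IsUnitalAssociative 𝒱.mulTilde (𝒱.OTilde.mkQ 𝒱.vacuum) := by
  refine ⟨assoc_of_leftSymmetric_of_derivation _ ?_ ?_, ?_⟩
  -- Left symmetry: the surviving kernel b_1² equals κ b_2 + κ b_1, and the b_2 part lies in Õ(V).
  · intro a b c
    obtain ⟨u, rfl⟩ := 𝒱.OTilde.mkQ_surjective a
    obtain ⟨v, rfl⟩ := 𝒱.OTilde.mkQ_surjective b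
    obtain ⟨w, rfl⟩ := 𝒱.OTilde.mkQ_surjective c
    rw [mulTilde_commutator]
    simp only [mulTilde_mkQ]
    rw [← map_sub, ← sub_eq_zero, ← map_sub, Submodule.mkQ_apply, Submodule.Quotient.mk_eq_zero]
    have h1 := 𝒱.commutator_bulletKernel_mem u v w le_rfl
    have h2 := Submodule.smul_mem _ κ (𝒱.res_bulletKernel_mem_OTilde one_lt_two (𝒱.mode u 0 v) w)
    have h3 : 𝒱.res (bulletKernel 1 * bulletKernel 1) (𝒱.mode u 0 v) w =
        κ • 𝒱.res (bulletKernel 2) (𝒱.mode u 0 v) w +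
          κ • 𝒱.res (bulletKernel 1) (𝒱.mode u 0 v) w := by
      rw [bulletKernel_mul 0 1]
      simp [smul_add]
    rw [h3] at h1
    simp only [bullet_eq_res, map_smul, LinearMap.smul_apply]
    convert add_mem h1 h2 using 1
    abel
  -- Commutators are κ u_0, so this is the derivation property of u_0.
  · intro a b c
    obtain ⟨u, rfl⟩ := 𝒱.OTilde.mkQ_surjective a
    obtain ⟨v, rfl⟩ := 𝒱.OTilde.mkQ_surjective b
    obtain ⟨w, rfl⟩ := 𝒱.OTilde.mkQ_surjective c
    rw [mulTilde_mkQ 𝒱 v w, mulTilde_commutator, mulTilde_commutator, mulTilde_commutator,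
      mulTilde_mkQ, mulTilde_mkQ, ← map_add]
    simp only [bullet_eq_res, mode_zero_res, map_smul, LinearMap.smul_apply, smul_add]
  · intro a
    obtain ⟨u, rfl⟩ := 𝒱.OTilde.mkQ_surjective a
    rw [mulTilde_mkQ, mulTilde_mkQ, vacuum_bullet, bullet_vacuum]
    exact ⟨rfl, rfl⟩

theorem omega_mem_center (a : 𝒱.ATilde) :
    𝒱.mulTilde (𝒱.OTilde.mkQ 𝒱.omega) a = 𝒱.mulTilde a (𝒱.OTilde.mkQ 𝒱.omega) := by
  obtain ⟨u, rfl⟩ := 𝒱.OTilde.mkQ_surjective a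
  rw [← sub_eq_zero, mulTilde_commutator, Submodule.mkQ_apply, Submodule.Quotient.mk_eq_zero]
  exact Submodule.smul_mem _ _ (𝒱.range_L_neg_one_le ⟨u, rfl⟩)

/-- `Õ(V)` is spanned by the elements with `n = 2`. -/
theorem OTilde_eq_span :
    𝒱.OTilde = Submodule.span ℂ {x | ∃ u v : V, x = 𝒱.res (bulletKernel 2) u v} := by
  apply le_antisymm
  · rw [OTilde, Submodule.span_le]
    rintro _ ⟨n, hn, u, v, rfl⟩
    rw [resY_eq_res]
    induction n, hn using Nat.le_induction generalizing u v with
    | base => exact Submodule.subset_span ⟨u, v, rfl⟩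
    | succ n hn ih =>
      -- Replacing u by L(-1) u differentiates the kernel, and `deriv_bulletKernel` then isolates
      -- index n + 1 with the nonzero coefficient κn.
      have h1 := ih (𝒱.L (-1) u) v
      have h2 := ih u v
      rw [res_L_neg_one, deriv_bulletKernel] at h1
      have hc : κ * n ≠ 0 := mul_ne_zero twoPiI_ne_zero (Nat.cast_ne_zero.2 (by omega))
      rw [SetLike.mem_coe, ← Submodule.smul_mem_iff _ hc]
      have h3 := sub_mem (add_mem h1 (Submodule.smul_mem _ κ h2))
        (Submodule.smul_mem _ (κ * n) h2)
      convert h3 using 1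
      simp only [map_sub, map_smul, map_add, LinearMap.sub_apply, LinearMap.smul_apply,
        LinearMap.add_apply, smul_add]
      abel
  · rw [Submodule.span_le]
    rintro _ ⟨u, v, rfl⟩
    exact 𝒱.res_bulletKernel_mem_OTilde one_lt_two u v

end VertexOperatorAlgebra

namespace VertexOperatorAlgebra

open LaurentSeries

variable {V : Type*} [AddCommGroup V] [Module ℂ V] (𝒱 : VertexOperatorAlgebra V)

/-! ### Weights -/

/-- The decomposition of a vector into its homogeneous components. -/
def decompose : V ≃ₗ[ℂ] DirectSum ℤ fun n => 𝒱.grade n :=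
  (LinearEquiv.ofBijective (DirectSum.coeLinearMap 𝒱.grade) 𝒱.isInternal_grade).symm

theorem component_eq (n : ℤ) (v : V) : 𝒱.component n v = (𝒱.decompose v n : V) := rfl

theorem component_add (n : ℤ) (v w : V) :
    𝒱.component n (v + w) = 𝒱.component n v + 𝒱.component n w := by
  simp [component_eq]

theorem component_smul (n : ℤ) (c : ℂ) (v : V) :
    𝒱.component n (c • v) = c • 𝒱.component n v := by
  rw [component_eq, map_smul]
  rfl

theorem component_zero (n : ℤ) : 𝒱.component n 0 = 0 := by
  simp [component_eq]

theorem component_sub (n : ℤ) (v w : V) :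
    𝒱.component n (v - w) = 𝒱.component n v - 𝒱.component n w := by
  simp [component_eq]

theorem component_mem (n : ℤ) (v : V) : 𝒱.component n v ∈ 𝒱.grade n :=
  (𝒱.decompose v n).2

theorem decompose_of_mem {n : ℤ} {v : V} (hv : v ∈ 𝒱.grade n) :
    𝒱.decompose v = DirectSum.lof ℂ ℤ (fun n => 𝒱.grade n) n ⟨v, hv⟩ := by
  rw [decompose, LinearEquiv.symm_apply_eq]
  exact (DirectSum.coeLinearMap_lof 𝒱.grade n ⟨v, hv⟩).symm

theorem component_of_mem {n : ℤ} {v : V} (hv : v ∈ 𝒱.grade n) : 𝒱.component n v = v := by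
  rw [component_eq, decompose_of_mem 𝒱 hv, DirectSum.lof_apply]

theorem component_of_mem_ne {n m : ℤ} {v : V} (hv : v ∈ 𝒱.grade n) (h : m ≠ n) :
    𝒱.component m v = 0 := by
  rw [component_eq, decompose_of_mem 𝒱 hv, DirectSum.lof_eq_of,
    DirectSum.of_eq_of_ne _ _ _ h, ZeroMemClass.coe_zero]

/-- Induction on homogeneous vectors. -/
theorem grade_induction {P : V → Prop} (h0 : P 0) (hadd : ∀ v w, P v → P w → P (v + w))
    (hg : ∀ n, ∀ v ∈ 𝒱.grade n, P v) (v : V) : P v := by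
  have hv : v ∈ ⨆ n, 𝒱.grade n := by
    rw [𝒱.isInternal_grade.submodule_iSup_eq_top]; exact Submodule.mem_top
  exact Submodule.iSup_induction _ (motive := P) hv hg h0 hadd

theorem exists_eq_sum_component (v : V) :
    ∃ s : Finset ℤ, (∀ n ∉ s, 𝒱.component n v = 0) ∧ v = ∑ n ∈ s, 𝒱.component n v := by
  induction v using 𝒱.grade_induction with
  | h0 => exact ⟨∅, fun n _ => 𝒱.component_zero n, by simp⟩
  | hadd v w hv hw =>
    obtain ⟨s, hs, hv⟩ := hv
    obtain ⟨t, ht, hw⟩ := hw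
    refine ⟨s ∪ t, fun n hn => ?_, ?_⟩
    · rw [Finset.mem_union, not_or] at hn
      rw [component_add, hs n hn.1, ht n hn.2, add_zero]
    · simp only [component_add, Finset.sum_add_distrib]
      rw [← Finset.sum_subset Finset.subset_union_left fun n _ hn => hs n hn,
        ← Finset.sum_subset Finset.subset_union_right fun n _ hn => ht n hn, ← hv, ← hw]
  | hg n v hv =>
    refine ⟨{n}, fun m hm => 𝒱.component_of_mem_ne hv (by simpa using hm), ?_⟩
    rw [Finset.sum_singleton, 𝒱.component_of_mem hv]

theorem eq_zero_of_component {v : V} (h : ∀ n, 𝒱.component n v = 0) : v = 0 := by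
  obtain ⟨s, -, hs⟩ := 𝒱.exists_eq_sum_component v
  rw [hs]
  exact Finset.sum_eq_zero fun n _ => h n

theorem component_L_zero (n : ℤ) (v : V) :
    𝒱.component n (𝒱.L 0 v) = (n : ℂ) • 𝒱.component n v := by
  induction v using 𝒱.grade_induction with
  | h0 => simp [component_zero]
  | hadd v w hv hw => rw [map_add, component_add, component_add, hv, hw, smul_add]
  | hg m v hv =>
    have : 𝒱.L 0 v = (m : ℂ) • v := 𝒱.L_zero m v hv
    rw [this, component_smul]
    rcases eq_or_ne n m with rfl | h
    · rfl
    · rw [𝒱.component_of_mem_ne hv h, smul_zero, smul_zero]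

theorem L_zero_of_mem {n : ℤ} {v : V} (hv : v ∈ 𝒱.grade n) : 𝒱.L 0 v = (n : ℂ) • v :=
  𝒱.L_zero n v hv

theorem mem_grade_of_L_zero {n : ℤ} {v : V} (h : 𝒱.L 0 v = (n : ℂ) • v) : v ∈ 𝒱.grade n := by
  have key : ∀ m, m ≠ n → 𝒱.component m v = 0 := by
    intro m hm
    have h1 := 𝒱.component_L_zero m v
    rw [h, component_smul, ← sub_eq_zero, ← sub_smul, smul_eq_zero, sub_eq_zero,
      Int.cast_inj] at h1
    exact h1.resolve_left (Ne.symm hm)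
  have : v = 𝒱.component n v := by
    rw [← sub_eq_zero]
    refine 𝒱.eq_zero_of_component fun m => ?_
    rw [component_sub]
    rcases eq_or_ne m n with rfl | hm
    · rw [𝒱.component_of_mem (𝒱.component_mem m v), sub_self]
    · rw [key m hm, 𝒱.component_of_mem_ne (𝒱.component_mem n v) hm, sub_self]
  rw [this]
  exact 𝒱.component_mem n v

/-- In the commutator [L(0), u_n] only ω_0 u = L(-1) u and ω_1 u = L(0) u contribute, because the
binomials of 1 vanish from index 2 on. The weight is read off as an L(0)-eigenvalue. -/
theorem mode_mem_grade {k l : ℤ} {u v : V} (hu : u ∈ 𝒱.grade k) (hv : v ∈ 𝒱.grade l) (n : ℤ) :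
    𝒱.mode u n v ∈ 𝒱.grade (k + l - n - 1) := by
  apply mem_grade_of_L_zero
  obtain ⟨K, hK⟩ := 𝒱.exists_mode_eq_zero 𝒱.omega u
  have h := 𝒱.mode_commutator 𝒱.omega u v 1 n (K + 2) (fun i hi => hK i (by omega))
  rw [Finset.sum_range_succ', Finset.sum_range_succ', Finset.sum_eq_zero, zero_add] at h
  · have h0 : 𝒱.mode 𝒱.omega 1 v = (l : ℂ) • v := 𝒱.L_zero_of_mem hv
    have h1 : 𝒱.mode 𝒱.omega 1 u = (k : ℂ) • u := 𝒱.L_zero_of_mem hu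
    have h2 : 𝒱.mode (𝒱.mode 𝒱.omega 0 u) (1 + n) v = (-(1 + n : ℤ) : ℂ) •
        𝒱.mode u (1 + n - 1) v := 𝒱.L_neg_one u v (1 + n)
    rw [sub_eq_iff_eq_add, h0] at h
    simp only [zero_add, Nat.cast_zero, Nat.cast_one, sub_zero, h1, h2, mode_smul,
      Ring.choose_one_right, Ring.choose_zero_right, one_smul, add_sub_cancel_left, map_smul,
      LinearMap.smul_apply] at h
    rw [L_zero_eq, h, ← add_smul, ← add_smul]
    congr 1
    push_cast
    ring
  · intro i _
    rw [show (Ring.choose (1 : ℤ) (i + 1 + 1)) = 0 by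
      have := Ring.choose_natCast (R := ℤ) 1 (i + 1 + 1)
      rw [Nat.choose_eq_zero_of_lt (by omega)] at this
      simpa using this, zero_smul]

/-- The vectors with weights at most `n`. -/
def filt (n : ℤ) : Submodule ℂ V where
  carrier := {v | ∀ m, n < m → 𝒱.component m v = 0}
  add_mem' hv hw m hm := by rw [component_add, hv m hm, hw m hm, add_zero]
  zero_mem' m _ := 𝒱.component_zero m
  smul_mem' c v hv m hm := by rw [component_smul, hv m hm, smul_zero]

theorem filt_mono {n m : ℤ} (h : n ≤ m) : 𝒱.filt n ≤ 𝒱.filt m :=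
  fun _ hv k hk => hv k (by omega)

theorem grade_le_filt {n m : ℤ} (h : n ≤ m) : 𝒱.grade n ≤ 𝒱.filt m :=
  fun _ hv _ hk => 𝒱.component_of_mem_ne hv (by omega)

theorem exists_mem_filt (v : V) : ∃ n, v ∈ 𝒱.filt n := by
  obtain ⟨s, hs, -⟩ := 𝒱.exists_eq_sum_component v
  obtain ⟨n, hn⟩ := s.exists_le
  exact ⟨n, fun m hm => hs m fun h => absurd (hn m h) (by omega)⟩

/-- Boundedness of the weights from below makes the exponentials finite sums and lets downward
inductions on the filtration end. -/
theorem exists_filt_eq_bot : ∃ N : ℤ, 𝒱.filt N = ⊥ := by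
  obtain ⟨N, hN⟩ := 𝒱.grade_eq_bot
  refine ⟨N - 1, (Submodule.eq_bot_iff _).2 fun v hv => 𝒱.eq_zero_of_component fun n => ?_⟩
  rcases lt_or_ge n N with h | h
  · have := 𝒱.component_mem n v
    rwa [hN n h, Submodule.mem_bot] at this
  · exact hv n (by omega)

theorem sub_component_mem_filt {n : ℤ} {v : V} (hv : v ∈ 𝒱.filt n) :
    v - 𝒱.component n v ∈ 𝒱.filt (n - 1) := by
  intro m hm
  rw [component_sub]
  rcases eq_or_ne m n with rfl | h
  · rw [𝒱.component_of_mem (𝒱.component_mem m v), sub_self]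
  · rw [hv m (by omega), 𝒱.component_of_mem_ne (𝒱.component_mem n v) h, sub_self]

/-- Induction on the weight filtration. -/
theorem filt_induction {P : V → Prop} (n : ℤ) (h0 : P 0) (hadd : ∀ v w, P v → P w → P (v + w))
    (hg : ∀ m ≤ n, ∀ v ∈ 𝒱.grade m, P v) (v : V) (hv : v ∈ 𝒱.filt n) : P v := by
  obtain ⟨s, -, h⟩ := 𝒱.exists_eq_sum_component v
  rw [h]
  refine Finset.sum_induction _ P hadd h0 fun m _ => ?_
  rcases le_or_gt m n with hm | hm
  · exact hg m hm _ (𝒱.component_mem m v)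
  · rw [hv m hm]; exact h0

/-- `Res f(x) Y(u, x)` with `f ∈ x^a ℂ⟦x⟧` raises weights by at most `wt u - a - 1`. -/
theorem res_mem_filt {a k l : ℤ} {f : LaurentSeries ℂ} (hf : OrderGE a f) {u v : V}
    (hu : u ∈ 𝒱.filt k) (hv : v ∈ 𝒱.filt l) : 𝒱.res f u v ∈ 𝒱.filt (k + l - a - 1) := by
  refine 𝒱.filt_induction (P := fun u => 𝒱.res f u v ∈ 𝒱.filt (k + l - a - 1)) k (by simp)
    (fun u u' hu hu' => ?_) (fun m hm u hu => ?_) u hu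
  · rw [map_add, LinearMap.add_apply]; exact add_mem hu hu'
  refine 𝒱.filt_induction (P := fun v => 𝒱.res f u v ∈ 𝒱.filt (k + l - a - 1)) l (by simp)
    (fun v v' hv hv' => ?_) (fun m' hm' v hv => ?_) v hv
  · rw [map_add]; exact add_mem hv hv'
  obtain ⟨N, hN⟩ := 𝒱.exists_res_eq_zero u v
  refine induction_orderGE (P := fun f => 𝒱.res f u v ∈ 𝒱.filt (k + l - a - 1)) N a
    (fun f hf => ?_) (fun f g hf hg => ?_) (fun n c hn => ?_) f hf
  · rw [hN f hf]; exact zero_mem _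
  · rw [map_add, LinearMap.add_apply, LinearMap.add_apply]; exact add_mem hf hg
  · rw [res_single]
    exact Submodule.smul_mem _ _
      (𝒱.grade_le_filt (by omega) (𝒱.mode_mem_grade hu hv n))

/-- The leading term of `Res f(x) Y(u, x)` is the mode `u_a` if `f ∈ x^a (1 + xℂ⟦x⟧)`. -/
theorem res_sub_mode_mem_filt {a k l : ℤ} {f : LaurentSeries ℂ} (hf : Monic a f) {u v : V}
    (hu : u ∈ 𝒱.filt k) (hv : v ∈ 𝒱.filt l) :
    𝒱.res f u v - 𝒱.mode u a v ∈ 𝒱.filt (k + l - a - 2) := by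
  have h := orderGE_sub_single hf.1
  rw [hf.2] at h
  have := 𝒱.res_mem_filt h hu hv
  rw [map_sub, LinearMap.sub_apply, LinearMap.sub_apply, res_single, one_smul] at this
  rwa [show k + l - a - 2 = k + l - (a + 1) - 1 by ring]

end VertexOperatorAlgebra

/-! ### Divided powers and truncated Cauchy products. -/

/-- The divided power `d^k / k!` of an endomorphism. -/
def dividedPow {A : Type*} [AddCommGroup A] [Module ℂ A] (d : Module.End ℂ A) (k : ℕ) :
    Module.End ℂ A := (k.factorial : ℂ)⁻¹ • d ^ k

theorem dividedPow_zero {A : Type*} [AddCommGroup A] [Module ℂ A] (d : Module.End ℂ A) (a : A) :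
    dividedPow d 0 a = a := by
  simp [dividedPow]

theorem apply_dividedPow {A : Type*} [AddCommGroup A] [Module ℂ A] (d : Module.End ℂ A) (k : ℕ)
    (a : A) : d (dividedPow d k a) = ((k + 1 : ℕ) : ℂ) • dividedPow d (k + 1) a := by
  rw [dividedPow, dividedPow, LinearMap.smul_apply, LinearMap.smul_apply, map_smul, smul_smul,
    pow_succ', Module.End.mul_apply, Nat.factorial_succ]
  congr 1
  have : ((k + 1 : ℕ) : ℂ) ≠ 0 := Nat.cast_ne_zero.2 (by omega)
  push_cast at this ⊢
  field_simp

/-- The Leibniz rule for divided powers. -/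
theorem dividedPow_leibniz {A B C : Type*} [AddCommGroup A] [Module ℂ A] [AddCommGroup B]
    [Module ℂ B] [AddCommGroup C] [Module ℂ C] (β : A →ₗ[ℂ] B →ₗ[ℂ] C) (d : Module.End ℂ A)
    (d' : Module.End ℂ B) (d'' : Module.End ℂ C)
    (h : ∀ a b, d'' (β a b) = β (d a) b + β a (d' b)) (a : A) (b : B) (k : ℕ) :
    dividedPow d'' k (β a b) =
      ∑ p ∈ Finset.HasAntidiagonal.antidiagonal k, β (dividedPow d p.1 a) (dividedPow d' p.2 b) := by
  induction k with
  | zero => simp [dividedPow_zero]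
  | succ k ih =>
    have hk : ((k + 1 : ℕ) : ℂ) ≠ 0 := Nat.cast_ne_zero.2 (by omega)
    rw [← smul_right_inj hk, ← apply_dividedPow, ih, map_sum]
    simp only [h, apply_dividedPow, map_smul, LinearMap.smul_apply]
    rw [Finset.sum_add_distrib]
    have e1 := Finset.Nat.sum_antidiagonal_succ (n := k)
      (f := fun p => (p.1 : ℂ) • β (dividedPow d p.1 a) (dividedPow d' p.2 b))
    have e2 := Finset.Nat.sum_antidiagonal_succ' (n := k)
      (f := fun p => (p.2 : ℂ) • β (dividedPow d p.1 a) (dividedPow d' p.2 b))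
    simp only [Nat.cast_zero, zero_smul, zero_add] at e1 e2
    rw [← e1, ← e2, ← Finset.sum_add_distrib, Finset.smul_sum]
    refine Finset.sum_congr rfl fun p hp => ?_
    rw [Finset.HasAntidiagonal.mem_antidiagonal] at hp
    rw [← add_smul, ← hp]
    push_cast
    rfl

theorem sum_antidiagonal_eq_sum_filter {M : Type*} [AddCommMonoid M] (K : ℕ) (f : ℕ → ℕ → M) :
    ∑ k ∈ Finset.range K, ∑ p ∈ Finset.HasAntidiagonal.antidiagonal k, f p.1 p.2 =
      ∑ p ∈ (Finset.range K ×ˢ Finset.range K).filter (fun p => p.1 + p.2 < K), f p.1 p.2 := by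
  rw [Finset.sum_sigma']
  refine Finset.sum_bij' (fun x _ => x.2) (fun p _ => ⟨p.1 + p.2, p⟩) ?_ ?_ ?_ ?_ ?_
  · rintro ⟨k, i, j⟩ h
    simp only [Finset.mem_sigma, Finset.mem_range, Finset.HasAntidiagonal.mem_antidiagonal,
      Finset.mem_filter, Finset.mem_product] at h ⊢
    omega
  · rintro ⟨i, j⟩ h
    simp only [Finset.mem_sigma, Finset.mem_range, Finset.HasAntidiagonal.mem_antidiagonal,
      Finset.mem_filter, Finset.mem_product, and_true] at h ⊢
    omega
  · rintro ⟨k, i, j⟩ h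
    simp only [Finset.mem_sigma, Finset.HasAntidiagonal.mem_antidiagonal] at h
    obtain ⟨_, rfl⟩ := h
    rfl
  · rintro ⟨i, j⟩ h
    rfl
  · rintro ⟨k, i, j⟩ h
    rfl

theorem sum_antidiagonal_eq_sum_range {M : Type*} [AddCommMonoid M] (f : ℕ → ℕ → M) (K : ℕ)
    (hf : ∀ i j, K ≤ i + j → f i j = 0) :
    ∑ k ∈ Finset.range K, ∑ p ∈ Finset.HasAntidiagonal.antidiagonal k, f p.1 p.2 =
      ∑ i ∈ Finset.range K, ∑ j ∈ Finset.range K, f i j := by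
  rw [sum_antidiagonal_eq_sum_filter, Finset.sum_filter, ← Finset.sum_product']
  refine Finset.sum_congr rfl fun p _ => ?_
  split_ifs with h
  · rfl
  · exact (hf _ _ (not_lt.1 h)).symm

/-! ### The flow of `∑ A_j y^{j+1} d/dy` -/

/-- The power series `∑_{j ≥ 1} A_j y^{j+1}`. -/
def flowSeries : PowerSeries ℂ :=
  PowerSeries.mk fun n => if 2 ≤ n then logFlowCoeff (n - 1) else 0

/-- The vector field `∑_{j ≥ 1} A_j y^{j+1} d/dy` as an endomorphism of `ℂ⟦y⟧`. -/
def flowEnd : Module.End ℂ (PowerSeries ℂ) :=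
  LinearMap.mulLeft ℂ flowSeries ∘ₗ (PowerSeries.derivative ℂ).toLinearMap

/-- The Lie bracket of vector fields `q ↦ ℓ q' - ℓ' q` with `ℓ = ∑ A_j y^{j+1}`. -/
def flowBracket : Module.End ℂ (PowerSeries ℂ) :=
  flowEnd - LinearMap.mulLeft ℂ (PowerSeries.derivative ℂ flowSeries)

theorem flowEnd_apply (f : PowerSeries ℂ) :
    flowEnd f = flowSeries * PowerSeries.derivative ℂ f := rfl

theorem flowBracket_apply (f : PowerSeries ℂ) :
    flowBracket f = flowSeries * PowerSeries.derivative ℂ f -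
      PowerSeries.derivative ℂ flowSeries * f := rfl

theorem X_pow_dvd_derivative {f : PowerSeries ℂ} {n : ℕ} (h : PowerSeries.X ^ (n + 1) ∣ f) :
    PowerSeries.X ^ n ∣ PowerSeries.derivative ℂ f := by
  rw [PowerSeries.X_pow_dvd_iff] at *
  intro m hm
  rw [PowerSeries.coeff_derivative, h (m + 1) (by omega), zero_mul]

theorem X_sq_dvd_flowSeries : (PowerSeries.X : PowerSeries ℂ) ^ 2 ∣ flowSeries := by
  rw [PowerSeries.X_pow_dvd_iff]
  intro m hm
  rw [flowSeries, PowerSeries.coeff_mk, if_neg (by omega)]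

theorem X_pow_dvd_flowEnd {f : PowerSeries ℂ} {n : ℕ} (h : PowerSeries.X ^ (n + 1) ∣ f) :
    PowerSeries.X ^ (n + 2) ∣ flowEnd f := by
  rw [flowEnd_apply, add_comm n 2, pow_add]
  exact mul_dvd_mul X_sq_dvd_flowSeries (X_pow_dvd_derivative h)

theorem X_pow_dvd_flowBracket {f : PowerSeries ℂ} {n : ℕ} (h : PowerSeries.X ^ (n + 1) ∣ f) :
    PowerSeries.X ^ (n + 2) ∣ flowBracket f := by
  refine dvd_sub (X_pow_dvd_flowEnd h) ?_
  rw [show n + 2 = 1 + (n + 1) by ring, pow_add]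
  exact mul_dvd_mul (X_pow_dvd_derivative X_sq_dvd_flowSeries) h

theorem X_pow_dvd_dividedPow {d : Module.End ℂ (PowerSeries ℂ)}
    (hd : ∀ (n : ℕ) f, PowerSeries.X ^ (n + 1) ∣ f → PowerSeries.X ^ (n + 2) ∣ d f) (k : ℕ) :
    PowerSeries.X ^ (k + 1) ∣ dividedPow d k PowerSeries.X := by
  induction k with
  | zero => simp [dividedPow_zero]
  | succ k ih =>
    have h := hd k _ ih
    rw [apply_dividedPow] at h
    have hk : ((k + 1 : ℕ) : ℂ) ≠ 0 := Nat.cast_ne_zero.2 (by omega)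
    rw [PowerSeries.X_pow_dvd_iff] at h ⊢
    intro m hm
    have := h m hm
    rw [PowerSeries.coeff_smul, smul_eq_mul, mul_eq_zero] at this
    exact this.resolve_left hk

/-- A truncated form of the defining identity of the A_j: the k-th term of the exponential has order
at least k + 1, so the tail from K on starts at order K + 1. -/
theorem X_pow_dvd_scaledLog_sub (K : ℕ) :
    PowerSeries.X ^ (K + 1) ∣
      scaledLog - ∑ k ∈ Finset.range K, dividedPow flowEnd k PowerSeries.X := by
  rw [PowerSeries.X_pow_dvd_iff]
  intro m hm
  have hit : ∀ k, (flowField logFlowCoeff)^[k] PowerSeries.X = (flowEnd ^ k) PowerSeries.X := by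
    intro k
    rw [Module.End.coe_pow]
    rfl
  have hd : ∀ k, m ≤ k → PowerSeries.coeff m (dividedPow flowEnd k PowerSeries.X) = 0 :=
    fun k hk => PowerSeries.X_pow_dvd_iff.1 (X_pow_dvd_dividedPow
      (fun n f => X_pow_dvd_flowEnd) k) m (by omega)
  rw [map_sub, ← logFlowCoeff_spec.2 m, sub_eq_zero, map_sum, map_sum]
  simp only [hit]
  change ∑ k ∈ _, PowerSeries.coeff m (dividedPow flowEnd k PowerSeries.X) = _
  rw [← Finset.sum_subset (Finset.range_mono (show m ≤ m + 1 by omega)),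
    ← Finset.sum_subset (Finset.range_mono (show m ≤ K by omega))]
  all_goals
    intro k _ hk
    rw [Finset.mem_range, not_lt] at hk
    exact hd k hk

theorem one_add_mul_derivative_scaledLog :
    (1 + PowerSeries.C κ * PowerSeries.X) * PowerSeries.derivative ℂ scaledLog = 1 := by
  ext n
  rw [add_mul, one_mul, mul_assoc, map_add, PowerSeries.coeff_C_mul]
  cases n with
  | zero => simp [scaledLog, PowerSeries.coeff_derivative]
  | succ n =>
    rw [mul_comm PowerSeries.X, PowerSeries.coeff_succ_mul_X, PowerSeries.coeff_derivative,
      PowerSeries.coeff_derivative, PowerSeries.coeff_one, if_neg (by omega), scaledLog,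
      PowerSeries.coeff_mk, PowerSeries.coeff_mk, if_neg (by omega), if_neg (by omega)]
    have h1 : (n : ℂ) + 1 ≠ 0 := Nat.cast_add_one_ne_zero n
    have h2 : (n : ℂ) + 1 + 1 ≠ 0 := by exact_mod_cast Nat.cast_add_one_ne_zero (R := ℂ) (n + 1)
    simp only [Nat.add_sub_cancel]
    push_cast
    field_simp
    ring

/-- The pushforward of the Euler vector field under the flow: the sum of the series
`exp(ad)(y d/dy)` is `(1 + 2πiy) (1 / 2πi) log (1 + 2πiy) d/dy`. -/
theorem X_pow_dvd_euler_sub (K : ℕ) :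
    PowerSeries.X ^ (K + 1) ∣ (1 + PowerSeries.C κ * PowerSeries.X) * scaledLog -
      ∑ k ∈ Finset.range K, dividedPow flowBracket k PowerSeries.X := by
  set S := ∑ k ∈ Finset.range K, dividedPow flowBracket k PowerSeries.X with hS
  set T := ∑ k ∈ Finset.range K, dividedPow flowEnd k PowerSeries.X with hT
  set a := fun k => dividedPow flowBracket k PowerSeries.X with ha
  set t := fun k => dividedPow flowEnd k PowerSeries.X with ht
  set D := PowerSeries.derivative ℂ with hD
  have ha' : ∀ k, PowerSeries.X ^ (k + 1) ∣ a k := fun k =>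
    X_pow_dvd_dividedPow (fun n f => X_pow_dvd_flowBracket) k
  have ht' : ∀ k, PowerSeries.X ^ k ∣ D (t k) := fun k =>
    X_pow_dvd_derivative (X_pow_dvd_dividedPow (fun n f => X_pow_dvd_flowEnd) k)
  -- With ℓ = `flowSeries`, the field ℓ d/dy acts on q h' through the bracket on q and through
  -- itself on h. Starting from y · y' = y, this gives T = S T' in the limit.
  have hleib : ∀ k, t k = ∑ p ∈ Finset.HasAntidiagonal.antidiagonal k, a p.1 * D (t p.2) := by
    intro k
    have := dividedPow_leibniz ((LinearMap.mul ℂ (PowerSeries ℂ)).compl₂ D.toLinearMap)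
      flowBracket flowEnd flowEnd (fun q h => by
        simp only [LinearMap.compl₂_apply, LinearMap.mul_apply',
          Derivation.coeFn_coe, flowEnd_apply, flowBracket_apply, Derivation.leibniz,
          smul_eq_mul]
        ring) PowerSeries.X PowerSeries.X k
    simpa [hD] using this
  have h1 : PowerSeries.X ^ (K + 1) ∣ S * D T - T := by
    have hsq : S * D T = ∑ p ∈ Finset.range K ×ˢ Finset.range K, a p.1 * D (t p.2) := by
      rw [hS, hT, map_sum, Finset.sum_mul_sum, Finset.sum_product]
    have htri : T = ∑ p ∈ (Finset.range K ×ˢ Finset.range K).filter (fun p => p.1 + p.2 < K),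
        a p.1 * D (t p.2) := by
      rw [hT, ← sum_antidiagonal_eq_sum_filter K fun i j => a i * D (t j)]
      exact Finset.sum_congr rfl fun k _ => hleib k
    rw [hsq, htri, ← Finset.sum_filter_add_sum_filter_not _ (fun p : ℕ × ℕ => p.1 + p.2 < K),
      add_sub_cancel_left]
    refine Finset.dvd_sum fun p hp => ?_
    rw [Finset.mem_filter, not_lt] at hp
    have := mul_dvd_mul (ha' p.1) (ht' p.2)
    rw [← pow_add] at this
    exact (pow_dvd_pow _ (by omega)).trans this
  have h2 : PowerSeries.X ^ (K + 1) ∣ scaledLog - T := X_pow_dvd_scaledLog_sub K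
  have h3 : PowerSeries.X ^ (K + 1) ∣ S * D (scaledLog - T) := by
    have hSX : PowerSeries.X ∣ S := Finset.dvd_sum fun k _ =>
      (dvd_pow_self _ (Nat.succ_ne_zero k)).trans (ha' k)
    rw [pow_succ']
    exact mul_dvd_mul hSX (X_pow_dvd_derivative h2)
  -- Since (1 + κy) scaledLog' = 1, the relation scaledLog = S scaledLog', valid up to the three
  -- errors, is solved for S.
  have e : (1 + PowerSeries.C κ * PowerSeries.X) * scaledLog - S =
      (1 + PowerSeries.C κ * PowerSeries.X) * ((scaledLog - T) - (S * D T - T) -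
        S * D (scaledLog - T)) := by
    have := one_add_mul_derivative_scaledLog
    rw [← hD] at this
    rw [map_sub]
    linear_combination S * this
  rw [e]
  exact Dvd.dvd.mul_left (dvd_sub (dvd_sub h2 h1) h3) _

namespace LaurentSeries

theorem orderGE_of_X_pow_dvd {n : ℕ} {p : PowerSeries ℂ} (h : PowerSeries.X ^ n ∣ p) :
    OrderGE n (HahnSeries.ofPowerSeries ℤ ℂ p) := by
  rw [PowerSeries.X_pow_dvd_iff] at h
  intro m hm
  rw [PowerSeries.coeff_coe]
  split_ifs with h'
  · rfl
  · exact h _ (by omega)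

theorem orderGE_hasseDeriv_ofPowerSeries (i : ℕ) (p : PowerSeries ℂ) :
    OrderGE 0 (hasseDeriv ℂ i (HahnSeries.ofPowerSeries ℤ ℂ p)) := by
  intro m hm
  rw [hasseDeriv_coeff]
  rcases lt_or_ge (m + i) 0 with h | h
  · rw [orderGE_ofPowerSeries p _ h, smul_zero]
  · obtain ⟨j, hj⟩ := Int.eq_ofNat_of_zero_le h
    rw [hj, Ring.choose_natCast, Nat.choose_eq_zero_of_lt (by omega), Nat.cast_zero, zero_smul]

end LaurentSeries

namespace VertexOperatorAlgebra

open LaurentSeries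

variable {V : Type*} [AddCommGroup V] [Module ℂ V] (𝒱 : VertexOperatorAlgebra V)

/-! ### Virasoro operators attached to vector fields -/

/-- The operator `∑ pⱼ L(j - 1)` attached to the vector field `p(y) d/dy`. -/
def vir : PowerSeries ℂ →ₗ[ℂ] Module.End ℂ V where
  toFun p := 𝒱.res (HahnSeries.ofPowerSeries ℤ ℂ p) 𝒱.omega
  map_add' p q := by rw [map_add, map_add, LinearMap.add_apply]
  map_smul' c p := by
    rw [PowerSeries.smul_eq_C_mul, map_mul, HahnSeries.ofPowerSeries_C,
      HahnSeries.C_mul_eq_smul, map_smul]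
    rfl

theorem vir_apply (p : PowerSeries ℂ) (v : V) :
    𝒱.vir p v = 𝒱.res (HahnSeries.ofPowerSeries ℤ ℂ p) 𝒱.omega v := rfl

theorem res_ofPowerSeries_eq_sum (p : PowerSeries ℂ) {u v : V} {K : ℕ}
    (hK : ∀ i : ℕ, K ≤ i → 𝒱.mode u i v = 0) :
    𝒱.res (HahnSeries.ofPowerSeries ℤ ℂ p) u v =
      ∑ i ∈ Finset.range K, PowerSeries.coeff i p • 𝒱.mode u i v := by
  have key : ∀ f, OrderGE 0 f → 𝒱.res f u v =
      ∑ i ∈ Finset.range K, f.coeff i • 𝒱.mode u i v := by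
    obtain ⟨N, hN⟩ := 𝒱.exists_res_eq_zero u v
    refine induction_orderGE (max N K) 0 (fun f hf => ?_) (fun f g hf hg => ?_)
      (fun n c hn => ?_)
    · rw [hN f (hf.mono (by omega)), Finset.sum_eq_zero]
      intro i hi
      rw [Finset.mem_range] at hi
      rw [hf i (by omega), zero_smul]
    · simp only [map_add, LinearMap.add_apply, hf, hg, HahnSeries.coeff_add, add_smul,
        Finset.sum_add_distrib]
    · lift n to ℕ using hn
      rw [res_single]
      rcases lt_or_ge n K with h | h
      · rw [Finset.sum_eq_single n, HahnSeries.coeff_single_same]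
        · intro i _ hi
          rw [HahnSeries.coeff_single_of_ne (by exact_mod_cast hi), zero_smul]
        · intro hn
          exact absurd (Finset.mem_range.2 h) hn
      · rw [hK n h, smul_zero, Finset.sum_eq_zero]
        intro i hi
        rw [Finset.mem_range] at hi
        rw [HahnSeries.coeff_single_of_ne (by omega), zero_smul]
  rw [key _ (orderGE_ofPowerSeries p)]
  refine Finset.sum_congr rfl fun i _ => ?_
  rw [PowerSeries.coeff_coe, if_neg (by omega), Int.natAbs_natCast]

theorem vir_mem_filt {p : PowerSeries ℂ} {n : ℕ} (hp : PowerSeries.X ^ n ∣ p) {l : ℤ} {v : V}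
    (hv : v ∈ 𝒱.filt l) : 𝒱.vir p v ∈ 𝒱.filt (l + 1 - n) := by
  have := 𝒱.res_mem_filt (orderGE_of_X_pow_dvd hp) (𝒱.grade_le_filt le_rfl 𝒱.omega_mem) hv
  rwa [show 2 + l - n - 1 = l + 1 - n by ring] at this

theorem vir_X (v : V) : 𝒱.vir PowerSeries.X v = 𝒱.L 0 v := by
  rw [vir_apply, HahnSeries.ofPowerSeries_X, res_single, one_smul, L_zero_eq]

theorem mode_omega_omega (i : ℕ) : ∃ c : ℂ, 𝒱.mode 𝒱.omega (i + 2) 𝒱.omega = c • 𝒱.vacuum := by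
  have h := 𝒱.virasoro (i + 1) (-2) 𝒱.vacuum
  have h1 : 𝒱.mode 𝒱.omega (-2 + 1) 𝒱.vacuum = 𝒱.omega := 𝒱.mode_neg_one_vacuum _
  have h2 : 𝒱.mode 𝒱.omega (i + 1 + 1) 𝒱.vacuum = 0 :=
    𝒱.mode_vacuum_eq_zero _ _ (by omega)
  have h3 : 𝒱.mode 𝒱.omega (i + 1 + -2 + 1) 𝒱.vacuum = 0 :=
    𝒱.mode_vacuum_eq_zero _ _ (by omega)
  simp only [mode] at h1 h2 h3
  rw [h1, h2, h3, map_zero, sub_zero, smul_zero, zero_add] at h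
  rw [mode, show (i : ℤ) + 2 = i + 1 + 1 by ring, h]
  exact ⟨_, rfl⟩

theorem mode_one_omega : 𝒱.mode 𝒱.omega 1 𝒱.omega = (2 : ℂ) • 𝒱.omega := by
  have h := 𝒱.L_zero_of_mem 𝒱.omega_mem
  rw [L_zero_eq] at h
  exact_mod_cast h

/-- The term i = 0 is L(-1)ω, which differentiates the kernel p q; the term i = 1 is 2 p' q. For i ≥
2 the vectors ω_i ω are multiples of the vacuum and pair with regular kernels, so no central term
appears. -/
theorem vir_bracket (p q : PowerSeries ℂ) (v : V) :
    𝒱.vir p (𝒱.vir q v) - 𝒱.vir q (𝒱.vir p v) =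
      𝒱.vir (PowerSeries.derivative ℂ p * q - p * PowerSeries.derivative ℂ q) v := by
  obtain ⟨K, hK⟩ := 𝒱.exists_mode_eq_zero 𝒱.omega 𝒱.omega
  simp only [vir_apply]
  rw [𝒱.res_commutator _ _ 𝒱.omega 𝒱.omega v (K + 2) (fun i hi => hK i (by omega)),
    Finset.sum_range_succ', Finset.sum_range_succ', Finset.sum_eq_zero, zero_add,
    hasseDeriv_zero, zero_add, hasseDeriv_one_eq, LinearMap.id_apply, Nat.cast_zero, Nat.cast_one,
    mode_one_omega, ← L_neg_one_eq, res_L_neg_one, deriv_mul, deriv_ofPowerSeries,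
    deriv_ofPowerSeries, map_sub, map_mul (HahnSeries.ofPowerSeries ℤ ℂ),
    map_mul (HahnSeries.ofPowerSeries ℤ ℂ)]
  · simp only [map_add, map_sub, LinearMap.add_apply, LinearMap.sub_apply, two_smul]
    abel
  · intro i _
    obtain ⟨c, hc⟩ := 𝒱.mode_omega_omega i
    rw [show ((i + 1 + 1 : ℕ) : ℤ) = i + 2 by push_cast; ring, hc, map_smul, LinearMap.smul_apply,
      res_vacuum]
    have := (orderGE_hasseDeriv_ofPowerSeries (i + 1 + 1) p).mul (orderGE_ofPowerSeries q)
    rw [this (-1) (by omega), zero_smul, smul_zero]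

/-! ### The operator `exp (-∑ A_j L(j))` -/

/-- The operator `-∑_{j ≥ 1} A_j L(j)`. -/
def negLPlus : Module.End ℂ V := -𝒱.vir flowSeries

theorem LPlus_eq (v : V) : 𝒱.LPlus v = 𝒱.vir flowSeries v := by
  obtain ⟨K, hK⟩ := 𝒱.exists_mode_eq_zero 𝒱.omega v
  rw [vir_apply, 𝒱.res_ofPowerSeries_eq_sum _ (K := K + 2) (fun i hi => hK i (by omega)),
    Finset.sum_range_succ', Finset.sum_range_succ', LPlus,
    finsum_eq_sum_of_support_subset (s := Finset.range K)]
  · simp only [flowSeries, PowerSeries.coeff_mk]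
    rw [if_neg (by omega), if_neg (by omega), zero_smul, zero_smul, add_zero, add_zero]
    refine Finset.sum_congr rfl fun i _ => ?_
    rw [if_pos (by omega)]
    rfl
  · intro i hi
    rw [Function.mem_support] at hi
    rw [Finset.coe_range, Set.mem_Iio]
    by_contra! h
    apply hi
    have : 𝒱.L (i + 1) v = 0 := hK _ (by omega)
    rw [this, smul_zero]

theorem negLPlus_mem_filt {l : ℤ} {v : V} (hv : v ∈ 𝒱.filt l) :
    𝒱.negLPlus v ∈ 𝒱.filt (l - 1) := by
  have := neg_mem (𝒱.vir_mem_filt X_sq_dvd_flowSeries hv)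
  rwa [show l + 1 - (2 : ℕ) = l - 1 by push_cast; ring] at this

theorem dividedPow_negLPlus_mem_filt {l : ℤ} {v : V} (hv : v ∈ 𝒱.filt l) (k : ℕ) :
    dividedPow 𝒱.negLPlus k v ∈ 𝒱.filt (l - k) := by
  induction k with
  | zero => simpa [dividedPow_zero] using hv
  | succ k ih =>
    have h := 𝒱.negLPlus_mem_filt ih
    rw [apply_dividedPow, Submodule.smul_mem_iff _ (Nat.cast_ne_zero.2 (by omega))] at h
    rwa [show l - (k + 1 : ℕ) = l - k - 1 by push_cast; ring]

theorem expNegLPlus_eq_sum {v : V} {K : ℕ}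
    (hK : ∀ k, K ≤ k → dividedPow 𝒱.negLPlus k v = 0) :
    𝒱.expNegLPlus v = ∑ k ∈ Finset.range K, dividedPow 𝒱.negLPlus k v := by
  have hL : 𝒱.LPlus = 𝒱.vir flowSeries := funext 𝒱.LPlus_eq
  have h : ∀ k : ℕ, ((-1 : ℂ) ^ k / (k.factorial : ℂ)) • 𝒱.LPlus^[k] v =
      dividedPow 𝒱.negLPlus k v := by
    intro k
    rw [dividedPow, negLPlus, neg_pow (𝒱.vir flowSeries), hL, ← Module.End.coe_pow, LinearMap.smul_apply,
      Module.End.mul_apply, div_eq_inv_mul, mul_smul]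
    congr 1
    rcases Nat.even_or_odd k with hk | hk
    · simp [hk.neg_one_pow]
    · simp [hk.neg_one_pow]
  rw [expNegLPlus]
  simp only [h]
  rw [finsum_eq_sum_of_support_subset]
  intro k hk
  rw [Function.mem_support] at hk
  rw [Finset.coe_range, Set.mem_Iio]
  by_contra! hlt
  exact hk (hK k hlt)

theorem exists_dividedPow_eq_zero (v : V) :
    ∃ K : ℕ, ∀ k, K ≤ k → dividedPow 𝒱.negLPlus k v = 0 := by
  obtain ⟨n, hn⟩ := 𝒱.exists_mem_filt v
  obtain ⟨N, hN⟩ := 𝒱.exists_filt_eq_bot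
  refine ⟨(n - N).toNat, fun k hk => ?_⟩
  have := 𝒱.filt_mono (show n - k ≤ N by omega) (𝒱.dividedPow_negLPlus_mem_filt hn k)
  rwa [hN, Submodule.mem_bot] at this

/-- `exp (-∑ A_j L(j))` as a linear map. -/
def expEnd : Module.End ℂ V where
  toFun := 𝒱.expNegLPlus
  map_add' v w := by
    obtain ⟨K, hK⟩ := 𝒱.exists_dividedPow_eq_zero v
    obtain ⟨M, hM⟩ := 𝒱.exists_dividedPow_eq_zero w
    rw [𝒱.expNegLPlus_eq_sum (K := max K M) (fun k hk => hK k (by omega)),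
      𝒱.expNegLPlus_eq_sum (K := max K M) (fun k hk => hM k (by omega)),
      𝒱.expNegLPlus_eq_sum (K := max K M) (fun k hk => by
        rw [map_add, hK k (by omega), hM k (by omega), add_zero]), ← Finset.sum_add_distrib]
    simp only [map_add]
  map_smul' c v := by
    obtain ⟨K, hK⟩ := 𝒱.exists_dividedPow_eq_zero v
    rw [𝒱.expNegLPlus_eq_sum hK, 𝒱.expNegLPlus_eq_sum (K := K) (fun k hk => by
        rw [map_smul, hK k hk, smul_zero]), RingHom.id_apply, Finset.smul_sum]
    simp only [map_smul]

theorem expEnd_eq_sum {v : V} {K : ℕ}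
    (hK : ∀ k, K ≤ k → dividedPow 𝒱.negLPlus k v = 0) :
    𝒱.expEnd v = ∑ k ∈ Finset.range K, dividedPow 𝒱.negLPlus k v :=
  𝒱.expNegLPlus_eq_sum hK

theorem expEnd_sub_mem_filt {l : ℤ} {v : V} (hv : v ∈ 𝒱.filt l) :
    𝒱.expEnd v - v ∈ 𝒱.filt (l - 1) := by
  obtain ⟨K, hK⟩ := 𝒱.exists_dividedPow_eq_zero v
  rw [𝒱.expEnd_eq_sum (K := K + 1) (fun k hk => hK k (by omega)), Finset.sum_range_succ',
    dividedPow_zero, add_sub_cancel_right]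
  exact Submodule.sum_mem _ fun k _ =>
    𝒱.filt_mono (by push_cast; omega) (𝒱.dividedPow_negLPlus_mem_filt hv (k + 1))

/-- Conjugation of `L(0)` by `exp (-∑ A_j L(j))`. -/
theorem vir_expEnd (v : V) :
    𝒱.vir ((1 + PowerSeries.C κ * PowerSeries.X) * scaledLog) (𝒱.expEnd v) =
      𝒱.expEnd (𝒱.L 0 v) := by
  obtain ⟨n, hn⟩ := 𝒱.exists_mem_filt v
  obtain ⟨N, hN⟩ := 𝒱.exists_filt_eq_bot
  have hz : ∀ {m : ℤ} {w : V}, w ∈ 𝒱.filt m → m ≤ N → w = 0 := by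
    intro m w hw hm
    have := 𝒱.filt_mono hm hw
    rwa [hN, Submodule.mem_bot] at this
  -- Beyond K steps down the filtration every vector is zero, so all series can be truncated at K.
  set K := (n - N).toNat with hKdef
  have hKn : n - K ≤ N := by omega
  set a := fun k => dividedPow flowBracket k PowerSeries.X with ha
  set b := fun k => dividedPow 𝒱.negLPlus k v with hb
  have hb' : ∀ k : ℕ, b k ∈ 𝒱.filt (n - k) := 𝒱.dividedPow_negLPlus_mem_filt hn
  have ha' : ∀ k, PowerSeries.X ^ (k + 1) ∣ a k := fun k =>
    X_pow_dvd_dividedPow (fun n f => X_pow_dvd_flowBracket) k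
  -- By `vir_bracket`, commuting with -vir ℓ acts on vector fields as `flowBracket`. Starting from
  -- L(0) = vir y, the operator exponential produces the flow of the Euler field.
  have hleib : ∀ k, dividedPow 𝒱.negLPlus k (𝒱.L 0 v) =
      ∑ p ∈ Finset.HasAntidiagonal.antidiagonal k, 𝒱.vir (a p.1) (b p.2) := by
    intro k
    rw [← vir_X]
    refine dividedPow_leibniz 𝒱.vir flowBracket 𝒱.negLPlus 𝒱.negLPlus (fun q w => ?_) _ v k
    have h := 𝒱.vir_bracket flowSeries q w
    rw [sub_eq_iff_eq_add] at h
    rw [negLPlus, LinearMap.neg_apply, LinearMap.neg_apply, h, map_neg, flowBracket_apply,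
      neg_add, ← LinearMap.neg_apply, ← map_neg, neg_sub]
  have hL : 𝒱.L 0 v ∈ 𝒱.filt n := by
    have := 𝒱.vir_mem_filt (p := PowerSeries.X) (n := 1) (by simp) hn
    rwa [vir_X, show n + 1 - (1 : ℕ) = n by push_cast; ring] at this
  have hvan : ∀ i j, K ≤ i + j → 𝒱.vir (a i) (b j) = 0 := by
    intro i j hij
    refine hz (𝒱.vir_mem_filt (ha' i) (hb' j)) ?_
    push_cast
    omega
  have hvzero : ∀ k, K ≤ k → b k = 0 := fun k hk => hz (hb' k) (by omega)
  have hLzero : ∀ k, K ≤ k → dividedPow 𝒱.negLPlus k (𝒱.L 0 v) = 0 := fun k hk =>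
    hz (𝒱.dividedPow_negLPlus_mem_filt hL k) (by omega)
  have hE : 𝒱.expEnd v ∈ 𝒱.filt n := by
    have := add_mem (𝒱.filt_mono (by omega) (𝒱.expEnd_sub_mem_filt hn)) hn
    rwa [sub_add_cancel] at this
  have h1 := 𝒱.vir_mem_filt (X_pow_dvd_euler_sub K) hE
  have h2 := hz h1 (by push_cast; omega)
  rw [map_sub, LinearMap.sub_apply, sub_eq_zero] at h2
  rw [h2, 𝒱.expEnd_eq_sum hLzero, 𝒱.expEnd_eq_sum hvzero, map_sum 𝒱.vir, LinearMap.sum_apply]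
  simp only [map_sum]
  change ∑ i ∈ Finset.range K, ∑ j ∈ Finset.range K, 𝒱.vir (a i) (b j) = _
  rw [Finset.sum_congr rfl fun k _ => hleib k,
    sum_antidiagonal_eq_sum_range (fun i j => 𝒱.vir (a i) (b j)) K hvan]

end VertexOperatorAlgebra

namespace LaurentSeries

/-! ### The substitution `x = (1 / 2πi) log (1 + y)` -/

theorem one_add_X_mul_derivative_log :
    (1 + PowerSeries.X) * PowerSeries.derivative ℂ (PowerSeries.log ℂ) = 1 := by
  rw [PowerSeries.deriv_log]
  ext n
  rw [add_mul, one_mul, map_add]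
  cases n with
  | zero => simp
  | succ n =>
    rw [mul_comm PowerSeries.X, PowerSeries.coeff_succ_mul_X, PowerSeries.coeff_mk,
      PowerSeries.coeff_mk, PowerSeries.coeff_one, if_neg (by omega), pow_succ, map_mul]
    simp

/-- The composite F satisfies (1 + y) F' = F and F(0) = 1, and these conditions determine its
coefficients recursively. -/
theorem exp_subst_log : (PowerSeries.exp ℂ).subst (PowerSeries.log ℂ) = 1 + PowerSeries.X := by
  have hs : PowerSeries.HasSubst (PowerSeries.log ℂ) := PowerSeries.HasSubst.log
  set F := (PowerSeries.exp ℂ).subst (PowerSeries.log ℂ) with hF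
  have h1 : (1 + PowerSeries.X) * PowerSeries.derivative ℂ F = F := by
    rw [hF, PowerSeries.derivative_subst hs, PowerSeries.derivative_exp, mul_left_comm,
      one_add_X_mul_derivative_log, mul_one]
  have h0 : PowerSeries.constantCoeff F = 1 := by
    have h := PowerSeries.constantCoeff_subst_eq_zero (a := PowerSeries.log ℂ)
      PowerSeries.constantCoeff_log (PowerSeries.exp ℂ - 1) (by simp)
    rw [PowerSeries.subst_sub hs, ← PowerSeries.coe_substAlgHom hs, map_one,
      PowerSeries.coe_substAlgHom hs] at h
    have h' : PowerSeries.constantCoeff (F - 1) = 0 := h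
    rwa [map_sub, map_one, sub_eq_zero] at h'
  ext n
  induction n with
  | zero => simpa using h0
  | succ n ih =>
    have h2 : (1 + PowerSeries.X) * PowerSeries.derivative ℂ (F - (1 + PowerSeries.X)) =
        F - (1 + PowerSeries.X) := by
      rw [map_sub, mul_sub, h1, map_add, PowerSeries.derivative_X]
      simp
    have h3 := congrArg (PowerSeries.coeff n) h2
    rw [← sub_eq_zero, ← map_sub] at ih ⊢
    generalize F - (1 + PowerSeries.X) = G at *
    rw [ih, add_mul, one_mul, map_add, PowerSeries.coeff_derivative] at h3
    have h4 : PowerSeries.coeff n (PowerSeries.X * PowerSeries.derivative ℂ G) = 0 := by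
      cases n with
      | zero => simp
      | succ n =>
        rw [mul_comm PowerSeries.X, PowerSeries.coeff_succ_mul_X, PowerSeries.coeff_derivative,
          ih, zero_mul]
    rw [h4, add_zero, mul_eq_zero] at h3
    exact h3.resolve_right (Nat.cast_add_one_ne_zero n)

/-- The power series `(1 / 2πi) log (1 + y)`. -/
def logCoordinate : PowerSeries ℂ := κ⁻¹ • PowerSeries.log ℂ

theorem hasSubst_logCoordinate : PowerSeries.HasSubst logCoordinate :=
  PowerSeries.HasSubst.of_constantCoeff_zero' (by simp [logCoordinate])

/-- The substitution `x = (1 / 2πi) log (1 + y)` on power series. -/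
def logSubstPowerSeries : PowerSeries ℂ →ₐ[ℂ] PowerSeries ℂ :=
  PowerSeries.substAlgHom hasSubst_logCoordinate

theorem logSubstPowerSeries_apply (p : PowerSeries ℂ) :
    logSubstPowerSeries p = p.subst logCoordinate :=
  congrFun (PowerSeries.coe_substAlgHom hasSubst_logCoordinate) p

/-- The linear coefficient κ⁻¹ is invertible, so the substitution has a compositional inverse.
Injectivity is what allows the extension to the fraction field ℂ((x)). -/
theorem logSubstPowerSeries_injective : Function.Injective logSubstPowerSeries := by
  have hu : IsUnit (PowerSeries.coeff 1 logCoordinate) := by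
    rw [logCoordinate, PowerSeries.coeff_smul, PowerSeries.coeff_one_log, smul_eq_mul, mul_one]
    exact (inv_ne_zero Complex.two_pi_I_ne_zero).isUnit
  have h0 : PowerSeries.constantCoeff logCoordinate = 0 := by simp [logCoordinate]
  intro p q h
  rw [logSubstPowerSeries_apply, logSubstPowerSeries_apply] at h
  have hc : ∀ r : PowerSeries ℂ,
      PowerSeries.subst (PowerSeries.substInvOfIsUnit logCoordinate hu)
        (PowerSeries.subst logCoordinate r) = r := by
    intro r
    rw [PowerSeries.subst_comp_subst_apply hasSubst_logCoordinate
      (PowerSeries.HasSubst.substInvOfIsUnit _ hu),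
      PowerSeries.subst_substInvOfIsUnit_right _ h0 hu, PowerSeries.X_subst]
  rw [← hc p, h, hc q]

theorem logSubstPowerSeries_X : logSubstPowerSeries PowerSeries.X = logCoordinate := by
  rw [logSubstPowerSeries_apply]
  exact PowerSeries.subst_X hasSubst_logCoordinate

theorem logSubstPowerSeries_exp :
    logSubstPowerSeries (PowerSeries.rescale κ (PowerSeries.exp ℂ)) = 1 + PowerSeries.X := by
  have hX : PowerSeries.HasSubst (κ • PowerSeries.X : PowerSeries ℂ) :=
    PowerSeries.HasSubst.smul_X' κ
  have e : (κ • PowerSeries.X : PowerSeries ℂ).subst logCoordinate = PowerSeries.log ℂ := by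
    rw [← logSubstPowerSeries_apply, map_smul, logSubstPowerSeries_X, logCoordinate, smul_smul,
      mul_inv_cancel₀ Complex.two_pi_I_ne_zero, one_smul]
  rw [logSubstPowerSeries_apply, PowerSeries.rescale_eq_subst,
    PowerSeries.subst_comp_subst_apply hX hasSubst_logCoordinate, e, exp_subst_log]

/-- The substitution `x = (1 / 2πi) log (1 + y)` on Laurent series. -/
def logSubst : LaurentSeries ℂ →+* LaurentSeries ℂ :=
  IsFractionRing.lift (A := PowerSeries ℂ)
    (g := (HahnSeries.ofPowerSeries ℤ ℂ).comp logSubstPowerSeries.toRingHom)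
    (HahnSeries.ofPowerSeries_injective.comp logSubstPowerSeries_injective)

theorem logSubst_ofPowerSeries (p : PowerSeries ℂ) :
    logSubst (HahnSeries.ofPowerSeries ℤ ℂ p) =
      HahnSeries.ofPowerSeries ℤ ℂ (logSubstPowerSeries p) :=
  IsFractionRing.lift_algebraMap (A := PowerSeries ℂ) (K := LaurentSeries ℂ) _ p

theorem logSubst_C (c : ℂ) : logSubst (HahnSeries.C c) = HahnSeries.C c := by
  rw [← HahnSeries.ofPowerSeries_C, logSubst_ofPowerSeries]
  congr 1
  exact logSubstPowerSeries.commutes c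

theorem logSubst_smul (c : ℂ) (f : LaurentSeries ℂ) : logSubst (c • f) = c • logSubst f := by
  rw [← HahnSeries.C_mul_eq_smul, map_mul, logSubst_C, HahnSeries.C_mul_eq_smul]

/-- The Laurent series `log (1 + y)`. -/
def logSeries : LaurentSeries ℂ := HahnSeries.ofPowerSeries ℤ ℂ (PowerSeries.log ℂ)

/-- The Laurent series `1 + y`. -/
def oneAdd : LaurentSeries ℂ := 1 + HahnSeries.single 1 1

theorem oneAdd_eq : oneAdd = HahnSeries.ofPowerSeries ℤ ℂ (1 + PowerSeries.X) := by
  rw [oneAdd, map_add, map_one (HahnSeries.ofPowerSeries ℤ ℂ), HahnSeries.ofPowerSeries_X]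

theorem monic_oneAdd : Monic 0 oneAdd := by
  refine ⟨by rw [oneAdd_eq]; exact orderGE_ofPowerSeries _, ?_⟩
  rw [oneAdd, HahnSeries.coeff_add, HahnSeries.coeff_single_of_ne (by norm_num)]
  simp

theorem oneAdd_ne_zero : oneAdd ≠ 0 := monic_oneAdd.ne_zero

theorem monic_logSeries : Monic 1 logSeries := by
  refine ⟨?_, ?_⟩
  · exact orderGE_of_X_pow_dvd (n := 1) (by
      rw [pow_one, PowerSeries.X_dvd_iff, PowerSeries.constantCoeff_log])
  · rw [logSeries, PowerSeries.coeff_coe, if_neg (by norm_num)]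
    exact PowerSeries.coeff_one_log

theorem logSeries_ne_zero : logSeries ≠ 0 := monic_logSeries.ne_zero

theorem deriv_logSeries : LaurentSeries.deriv logSeries = oneAdd⁻¹ := by
  apply eq_inv_of_mul_eq_one_right
  rw [logSeries, deriv_ofPowerSeries, oneAdd_eq, ← map_mul, one_add_X_mul_derivative_log, map_one]

theorem deriv_oneAdd : LaurentSeries.deriv oneAdd = 1 := by
  rw [oneAdd_eq, deriv_ofPowerSeries, map_add, PowerSeries.derivative_X]
  simp

theorem ofPowerSeries_logCoordinate :
    HahnSeries.ofPowerSeries ℤ ℂ logCoordinate = HahnSeries.C κ⁻¹ * logSeries := by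
  rw [logCoordinate, PowerSeries.smul_eq_C_mul, map_mul, HahnSeries.ofPowerSeries_C, logSeries]

theorem single_one_zpow (n : ℤ) :
    (HahnSeries.single 1 1 : LaurentSeries ℂ) ^ n = HahnSeries.single n 1 :=
  (RatFunc.single_zpow n).symm

theorem logSubst_single (n : ℤ) :
    logSubst (HahnSeries.single n 1) = κ ^ (-n) • logSeries ^ n := by
  rw [← single_one_zpow, map_zpow₀, ← HahnSeries.ofPowerSeries_X, logSubst_ofPowerSeries,
    logSubstPowerSeries_X, ofPowerSeries_logCoordinate, mul_zpow, ← map_zpow₀, inv_zpow', zpow_neg,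
    HahnSeries.C_mul_eq_smul]

theorem OrderGE.logSubst {n : ℤ} {f : LaurentSeries ℂ} (hf : OrderGE n f) :
    OrderGE n (logSubst f) := by
  have h1 : OrderGE 0 (HahnSeries.single (-n) 1 * f) := by
    have := (orderGE_single (-n) 1).mul hf
    rwa [neg_add_cancel] at this
  obtain ⟨p, hp⟩ : ∃ p, HahnSeries.ofPowerSeries ℤ ℂ p = HahnSeries.single (-n) 1 * f := by
    refine ⟨PowerSeries.mk fun m => (HahnSeries.single (-n) 1 * f).coeff m, ?_⟩
    ext m
    rw [PowerSeries.coeff_coe]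
    split_ifs with h
    · exact (h1 m h).symm
    · rw [PowerSeries.coeff_mk, Int.natAbs_of_nonneg (not_lt.1 h)]
  have h2 : f = HahnSeries.single n 1 * HahnSeries.ofPowerSeries ℤ ℂ p := by
    rw [hp, ← mul_assoc, HahnSeries.single_mul_single]
    simp
  rw [h2, map_mul, logSubst_single, logSubst_ofPowerSeries]
  have := ((monic_logSeries.zpow n).1.smul (κ ^ (-n))).mul
    (orderGE_ofPowerSeries (logSubstPowerSeries p))
  rwa [mul_one, add_zero] at this

end LaurentSeries

namespace VertexOperatorAlgebra

open LaurentSeries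

theorem logSubst_expSeries : logSubst expSeries = oneAdd := by
  rw [expSeries, logSubst_ofPowerSeries, logSubstPowerSeries_exp, oneAdd_eq]

theorem logSubst_bulletKernel (n : ℕ) :
    logSubst (bulletKernel n) = κ • (oneAdd / HahnSeries.single 1 1 ^ n) := by
  rw [bulletKernel, map_div₀, map_mul, map_pow, map_sub, map_one, logSubst_expSeries, logSubst_C,
    oneAdd, add_sub_cancel_left, mul_div_assoc, HahnSeries.C_mul_eq_smul]

/-! ### The vector field `(1 + y) log (1 + y) d/dy` -/

/-- The power series `(1 + y) log (1 + y)`. -/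
def eulerSeries : PowerSeries ℂ := (1 + PowerSeries.X) * PowerSeries.log ℂ

theorem ofPowerSeries_eulerSeries :
    HahnSeries.ofPowerSeries ℤ ℂ eulerSeries = oneAdd * logSeries := by
  rw [eulerSeries, map_mul, oneAdd_eq, logSeries]

theorem coeff_zero_eulerSeries : PowerSeries.coeff 0 eulerSeries = 0 := by
  simp [eulerSeries]

theorem coeff_one_eulerSeries : PowerSeries.coeff 1 eulerSeries = 1 := by
  rw [eulerSeries, add_mul, one_mul, map_add, mul_comm, PowerSeries.coeff_one_log,
    ← zero_add 1, PowerSeries.coeff_succ_mul_X]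
  simp

theorem X_sq_dvd_eulerSeries_sub : PowerSeries.X ^ 2 ∣ eulerSeries - PowerSeries.X := by
  rw [PowerSeries.X_pow_dvd_iff]
  intro m hm
  interval_cases m
  · rw [map_sub, coeff_zero_eulerSeries]; simp
  · rw [map_sub, coeff_one_eulerSeries]; simp

/-- This matches the factor κ^{L(0)} of 𝒰(1): rescaling (1 + y) log(1 + y) d/dy by κ gives the field
found in `X_pow_dvd_euler_sub`. -/
theorem rescale_eulerSeries :
    κ⁻¹ • PowerSeries.rescale κ eulerSeries =
      (1 + PowerSeries.C κ * PowerSeries.X) * scaledLog := by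
  have h : scaledLog = κ⁻¹ • PowerSeries.rescale κ (PowerSeries.log ℂ) := by
    ext m
    rw [PowerSeries.coeff_smul, PowerSeries.coeff_rescale, PowerSeries.coeff_log, scaledLog,
      PowerSeries.coeff_mk]
    split_ifs with hm
    · simp
    · obtain ⟨m, rfl⟩ : ∃ k, m = k + 1 := ⟨m - 1, by omega⟩
      have := Complex.two_pi_I_ne_zero
      have : (m : ℂ) + 1 ≠ 0 := Nat.cast_add_one_ne_zero m
      generalize κ = k at *
      simp [pow_succ]
      field_simp
  rw [h, eulerSeries, map_mul, map_add, map_one, PowerSeries.rescale_X, mul_smul_comm]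

theorem deriv_eulerSeries : LaurentSeries.deriv (oneAdd * logSeries) = logSeries + 1 := by
  rw [deriv_mul, deriv_logSeries, deriv_oneAdd, mul_inv_cancel₀ oneAdd_ne_zero]
  ring

/-- The second derivative of (1 + y) log(1 + y) is (1 + y)^{-1}, so all higher ones are multiples of
powers of 1 + y. The exponent -1 - i is exactly the weight shift of ω_{i+2} = L(i + 1), which is
what `vir_wres` needs. -/
theorem hasseDeriv_eulerSeries (i : ℕ) :
    hasseDeriv ℂ (i + 2) (oneAdd * logSeries) =
      PowerSeries.coeff (i + 2) eulerSeries • oneAdd ^ (-1 - i : ℤ) := by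
  have h : ∃ a : ℂ, hasseDeriv ℂ (i + 2) (oneAdd * logSeries) = a • oneAdd ^ (-1 - i : ℤ) := by
    induction i with
    | zero =>
      have h := deriv_hasseDeriv 1 (oneAdd * logSeries)
      rw [hasseDeriv_one_eq, deriv_eulerSeries, map_add, deriv_logSeries,
        ← HahnSeries.C_one, deriv_C, add_zero] at h
      refine ⟨((1 + 1 : ℕ) : ℂ)⁻¹, ?_⟩
      rw [Nat.cast_zero, sub_zero, zpow_neg_one, h, smul_smul, inv_mul_cancel₀, one_smul]
      norm_num
    | succ i ih =>
      obtain ⟨a, ha⟩ := ih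
      have h := deriv_hasseDeriv (i + 2) (oneAdd * logSeries)
      have hc : ((i + 2 + 1 : ℕ) : ℂ) ≠ 0 := Nat.cast_ne_zero.2 (by omega)
      rw [ha, LaurentSeries.deriv_smul, deriv_zpow, deriv_oneAdd, mul_one, HahnSeries.C_mul_eq_smul] at h
      refine ⟨((i + 2 + 1 : ℕ) : ℂ)⁻¹ * (a * ((-1 - i : ℤ) : ℂ)), ?_⟩
      rw [show i + 1 + 2 = i + 2 + 1 by ring, mul_smul, mul_smul,
        show (-1 - (i + 1 : ℕ) : ℤ) = -1 - i - 1 by push_cast; ring, h, smul_smul,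
        inv_mul_cancel₀ hc, one_smul]
  obtain ⟨a, ha⟩ := h
  -- The multiple is found by comparing constant terms.
  have h0 := congrArg (fun f => HahnSeries.coeff f 0) ha
  have h1 : (oneAdd ^ (-1 - i : ℤ)).coeff 0 = 1 := by
    have := (monic_oneAdd.zpow (-1 - i)).2
    rwa [mul_zero] at this
  simp only [hasseDeriv_coeff, HahnSeries.coeff_smul, h1, smul_eq_mul, mul_one, zero_add] at h0
  rw [← ofPowerSeries_eulerSeries, PowerSeries.coeff_coe, if_neg (by omega), Ring.choose_natCast,
    Nat.choose_self, Nat.cast_one, one_smul, Int.natAbs_natCast] at h0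
  rw [ha, h0]

end VertexOperatorAlgebra

namespace VertexOperatorAlgebra

open LaurentSeries

variable {V : Type*} [AddCommGroup V] [Module ℂ V] (𝒱 : VertexOperatorAlgebra V)

/-! ### Linear maps defined on homogeneous components -/

/-- The linear map that is `T n` on `V_(n)`. -/
def ofComponents {W : Type*} [AddCommGroup W] [Module ℂ W] (T : ℤ → V →ₗ[ℂ] W) : V →ₗ[ℂ] W :=
  (DirectSum.toModule ℂ ℤ W fun n => T n ∘ₗ (𝒱.grade n).subtype) ∘ₗ 𝒱.decompose.toLinearMap

theorem ofComponents_of_mem {W : Type*} [AddCommGroup W] [Module ℂ W] (T : ℤ → V →ₗ[ℂ] W)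
    {n : ℤ} {v : V} (hv : v ∈ 𝒱.grade n) : 𝒱.ofComponents T v = T n v := by
  rw [ofComponents, LinearMap.comp_apply, LinearEquiv.coe_coe, decompose_of_mem 𝒱 hv,
    DirectSum.toModule_lof]
  rfl

theorem finsum_component {W : Type*} [AddCommGroup W] [Module ℂ W] (T : ℤ → V →ₗ[ℂ] W) (v : V) :
    ∑ᶠ n, T n (𝒱.component n v) = 𝒱.ofComponents T v := by
  obtain ⟨s, hs, hv⟩ := 𝒱.exists_eq_sum_component v
  rw [finsum_eq_sum_of_support_subset (s := s)]
  · conv_rhs => rw [hv, map_sum]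
    exact Finset.sum_congr rfl fun n _ => (𝒱.ofComponents_of_mem T (𝒱.component_mem n v)).symm
  · intro n hn
    by_contra h
    exact hn (by simp only [hs n h, map_zero])

/-! ### The operator `𝒰(1)` -/

/-- The operator `(2πi)^{L(0)}` as a linear map. -/
def scaleEnd : Module.End ℂ V := 𝒱.ofComponents fun n => κ ^ n • LinearMap.id

theorem twoPiIPowL0_eq (v : V) : 𝒱.twoPiIPowL0 v = 𝒱.scaleEnd v := by
  rw [scaleEnd, ← finsum_component]
  rfl

theorem scaleEnd_of_mem {n : ℤ} {v : V} (hv : v ∈ 𝒱.grade n) : 𝒱.scaleEnd v = κ ^ n • v :=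
  𝒱.ofComponents_of_mem _ hv

theorem scaleEnd_mem_filt {n : ℤ} {v : V} (hv : v ∈ 𝒱.filt n) : 𝒱.scaleEnd v ∈ 𝒱.filt n := by
  refine 𝒱.filt_induction (P := fun v => 𝒱.scaleEnd v ∈ 𝒱.filt n) n (by simp)
    (fun v w hv hw => ?_) (fun m hm v hv => ?_) v hv
  · rw [map_add]; exact add_mem hv hw
  · rw [scaleEnd_of_mem 𝒱 hv]
    exact Submodule.smul_mem _ _ (𝒱.grade_le_filt hm hv)

/-- The mode ω_i lowers weights by i - 1, so conjugation by κ^{L(0)} multiplies the i-th coefficient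
by κ^{i-1}. -/
theorem vir_scaleEnd (q : PowerSeries ℂ) (v : V) :
    𝒱.vir q (𝒱.scaleEnd v) = 𝒱.scaleEnd (𝒱.vir (κ⁻¹ • PowerSeries.rescale κ q) v) := by
  induction v using 𝒱.grade_induction with
  | h0 => simp
  | hadd v w hv hw => simp only [map_add, hv, hw]
  | hg n v hv =>
    obtain ⟨K, hK⟩ := 𝒱.exists_mode_eq_zero 𝒱.omega v
    rw [scaleEnd_of_mem 𝒱 hv, map_smul, vir_apply, vir_apply,
      𝒱.res_ofPowerSeries_eq_sum q (K := K) (fun i hi => hK i (by omega)),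
      𝒱.res_ofPowerSeries_eq_sum _ (K := K) (fun i hi => hK i (by omega)), map_sum,
      Finset.smul_sum]
    refine Finset.sum_congr rfl fun i _ => ?_
    rw [map_smul, scaleEnd_of_mem 𝒱 (𝒱.mode_mem_grade 𝒱.omega_mem hv i), smul_smul, smul_smul,
      PowerSeries.coeff_smul, PowerSeries.coeff_rescale, smul_eq_mul]
    congr 1
    have h := twoPiI_ne_zero
    rw [show 2 + n - i - 1 = n + 1 - i by ring, zpow_sub₀ h, zpow_add_one₀ h, zpow_natCast]
    generalize κ = k at *
    field_simp

/-- `𝒰(1)` as a linear map. -/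
def uEnd : Module.End ℂ V := 𝒱.scaleEnd ∘ₗ 𝒱.expEnd

theorem U1_eq (v : V) : 𝒱.U1 v = 𝒱.uEnd v := 𝒱.twoPiIPowL0_eq _

/-- `𝒰(1)` intertwines `L(0)` with the operator `L[0]` attached to `(1 + y) log (1 + y) d/dy`. -/
theorem vir_uEnd (v : V) : 𝒱.vir eulerSeries (𝒱.uEnd v) = 𝒱.uEnd (𝒱.L 0 v) := by
  rw [uEnd, LinearMap.comp_apply, LinearMap.comp_apply, vir_scaleEnd, rescale_eulerSeries,
    vir_expEnd]

theorem uEnd_sub_mem_filt {n : ℤ} {v : V} (hv : v ∈ 𝒱.grade n) :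
    𝒱.uEnd v - κ ^ n • v ∈ 𝒱.filt (n - 1) := by
  rw [uEnd, LinearMap.comp_apply, ← scaleEnd_of_mem 𝒱 hv, ← map_sub]
  exact 𝒱.scaleEnd_mem_filt (𝒱.expEnd_sub_mem_filt (𝒱.grade_le_filt le_rfl hv))

theorem uEnd_mem_filt {n : ℤ} {v : V} (hv : v ∈ 𝒱.filt n) : 𝒱.uEnd v ∈ 𝒱.filt n := by
  refine 𝒱.scaleEnd_mem_filt ?_
  have := add_mem (𝒱.filt_mono (by omega) (𝒱.expEnd_sub_mem_filt hv)) hv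
  rwa [sub_add_cancel] at this

/-- Descending induction on the weight filtration. -/
theorem eq_zero_of_filt {v : V} (h : ∀ n, v ∈ 𝒱.filt n → 𝒱.component n v = 0) : v = 0 := by
  obtain ⟨n, hn⟩ := 𝒱.exists_mem_filt v
  obtain ⟨N, hN⟩ := 𝒱.exists_filt_eq_bot
  have key : ∀ k : ℕ, v ∈ 𝒱.filt (n - k) := by
    intro k
    induction k with
    | zero => simpa using hn
    | succ k ih =>
      have := 𝒱.sub_component_mem_filt ih
      rw [h _ ih, sub_zero] at this
      rwa [show n - (k + 1 : ℕ) = n - k - 1 by push_cast; ring]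
  have := 𝒱.filt_mono (show n - (n - N).toNat ≤ N by omega) (key _)
  rwa [hN, Submodule.mem_bot] at this

theorem uEnd_injective : Function.Injective 𝒱.uEnd := by
  rw [injective_iff_map_eq_zero]
  intro v hv
  refine 𝒱.eq_zero_of_filt fun n hn => ?_
  have h1 := 𝒱.uEnd_mem_filt (𝒱.sub_component_mem_filt hn)
  have h2 := 𝒱.uEnd_sub_mem_filt (𝒱.component_mem n v)
  have h3 := neg_mem (add_mem h1 h2)
  rw [map_sub, hv] at h3
  have h4 : κ ^ n • 𝒱.component n v ∈ 𝒱.filt (n - 1) := by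
    convert h3 using 1
    abel
  rw [Submodule.smul_mem_iff _ (zpow_ne_zero _ twoPiI_ne_zero)] at h4
  have := h4 n (by omega)
  rwa [𝒱.component_of_mem (𝒱.component_mem n v)] at this

theorem uEnd_surjective : Function.Surjective 𝒱.uEnd := by
  rw [← LinearMap.range_eq_top, Submodule.eq_top_iff']
  obtain ⟨N, hN⟩ := 𝒱.exists_filt_eq_bot
  have key : ∀ k : ℕ, 𝒱.filt (N + k) ≤ LinearMap.range 𝒱.uEnd := by
    intro k
    induction k with
    | zero => simp [hN]
    | succ k ih =>
      intro v hv
      set n := N + (k + 1 : ℕ) with hn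
      have hnk : n - 1 = N + k := by rw [hn]; push_cast; ring
      have h1 := 𝒱.uEnd_sub_mem_filt (𝒱.component_mem n v)
      have h2 := 𝒱.sub_component_mem_filt hv
      rw [hnk] at h1 h2
      have h3 : κ ^ n • 𝒱.component n v ∈ LinearMap.range 𝒱.uEnd := by
        have := sub_mem (⟨𝒱.component n v, rfl⟩ : 𝒱.uEnd (𝒱.component n v) ∈
          LinearMap.range 𝒱.uEnd) (ih h1)
        rwa [sub_sub_cancel] at this
      rw [Submodule.smul_mem_iff _ (zpow_ne_zero _ twoPiI_ne_zero)] at h3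
      have := add_mem (ih h2) h3
      rwa [sub_add_cancel] at this
  intro v
  obtain ⟨n, hn⟩ := 𝒱.exists_mem_filt v
  exact key (n - N).toNat (𝒱.filt_mono (by omega) hn)

theorem uEnd_vacuum : 𝒱.uEnd 𝒱.vacuum = 𝒱.vacuum := by
  have h1 : 𝒱.negLPlus 𝒱.vacuum = 0 := by
    rw [negLPlus, LinearMap.neg_apply, vir_apply, 𝒱.res_vacuum_right (orderGE_ofPowerSeries _),
      neg_zero]
  have h2 : ∀ k, 1 ≤ k → dividedPow 𝒱.negLPlus k 𝒱.vacuum = 0 := by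
    intro k hk
    obtain ⟨k, rfl⟩ : ∃ m, k = m + 1 := ⟨k - 1, by omega⟩
    rw [dividedPow, LinearMap.smul_apply, pow_succ, Module.End.mul_apply, h1, map_zero, smul_zero]
  rw [uEnd, LinearMap.comp_apply, 𝒱.expEnd_eq_sum h2, Finset.sum_range_one, dividedPow_zero,
    scaleEnd_of_mem 𝒱 𝒱.vacuum_mem, zpow_zero, one_smul]

/-! ### Weighted residues -/

/-- `Res_y h(y) Y((1 + y)^{L(0) - 1} u, y) v`. -/
def wres (h : LaurentSeries ℂ) : V →ₗ[ℂ] V →ₗ[ℂ] V :=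
  𝒱.ofComponents fun k => 𝒱.res (h * oneAdd ^ (k - 1))

theorem wres_of_mem (h : LaurentSeries ℂ) {k : ℤ} {u : V} (hu : u ∈ 𝒱.grade k) (v : V) :
    𝒱.wres h u v = 𝒱.res (h * oneAdd ^ (k - 1)) u v := by
  rw [wres, ofComponents_of_mem 𝒱 _ hu]

theorem wres_add (h h' : LaurentSeries ℂ) (u v : V) :
    𝒱.wres (h + h') u v = 𝒱.wres h u v + 𝒱.wres h' u v := by
  induction u using 𝒱.grade_induction with
  | h0 => simp
  | hadd u w hu hw =>
    simp only [map_add, LinearMap.add_apply, hu, hw]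
    abel
  | hg k u hu =>
    rw [wres_of_mem 𝒱 _ hu, wres_of_mem 𝒱 _ hu, wres_of_mem 𝒱 _ hu, add_mul, map_add]
    rfl

theorem wres_smul (c : ℂ) (h : LaurentSeries ℂ) (u v : V) :
    𝒱.wres (c • h) u v = c • 𝒱.wres h u v := by
  induction u using 𝒱.grade_induction with
  | h0 => simp
  | hadd u w hu hw => simp only [map_add, LinearMap.add_apply, hu, hw, smul_add]
  | hg k u hu =>
    rw [wres_of_mem 𝒱 _ hu, wres_of_mem 𝒱 _ hu, ← HahnSeries.C_mul_eq_smul, mul_assoc,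
      HahnSeries.C_mul_eq_smul, map_smul]
    rfl

theorem wres_mem_filt {a k l : ℤ} {h : LaurentSeries ℂ} (hh : OrderGE a h) {u v : V}
    (hu : u ∈ 𝒱.filt k) (hv : v ∈ 𝒱.filt l) : 𝒱.wres h u v ∈ 𝒱.filt (k + l - a - 1) := by
  refine 𝒱.filt_induction (P := fun u => 𝒱.wres h u v ∈ 𝒱.filt (k + l - a - 1)) k (by simp)
    (fun u u' hu hu' => ?_) (fun m hm u hu => ?_) u hu
  · rw [map_add, LinearMap.add_apply]; exact add_mem hu hu'
  · rw [wres_of_mem 𝒱 _ hu]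
    have h1 := hh.mul (monic_oneAdd.zpow (m - 1)).1
    rw [mul_zero, add_zero] at h1
    exact 𝒱.res_mem_filt h1 (𝒱.grade_le_filt hm hu) hv

theorem wres_sub_mode_mem_filt {a k l : ℤ} {h : LaurentSeries ℂ} (hh : Monic a h) {u v : V}
    (hu : u ∈ 𝒱.grade k) (hv : v ∈ 𝒱.filt l) :
    𝒱.wres h u v - 𝒱.mode u a v ∈ 𝒱.filt (k + l - a - 2) := by
  rw [wres_of_mem 𝒱 _ hu]
  have h1 := hh.mul (monic_oneAdd.zpow (k - 1))
  rw [mul_zero, add_zero] at h1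
  exact 𝒱.res_sub_mode_mem_filt h1 (𝒱.grade_le_filt le_rfl hu) hv

theorem exists_wres_eq_zero (u v : V) : ∃ N : ℤ, ∀ h, OrderGE N h → 𝒱.wres h u v = 0 := by
  obtain ⟨k, hk⟩ := 𝒱.exists_mem_filt u
  obtain ⟨l, hl⟩ := 𝒱.exists_mem_filt v
  obtain ⟨N, hN⟩ := 𝒱.exists_filt_eq_bot
  refine ⟨k + l - 1 - N, fun h hh => ?_⟩
  have := 𝒱.wres_mem_filt hh hk hl
  rwa [show k + l - (k + l - 1 - N) - 1 = N by ring, hN, Submodule.mem_bot] at this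

/-- `L[0]` acts on weighted residues by derivations, up to the action on the kernel. -/
theorem vir_wres (h : LaurentSeries ℂ) (u v : V) :
    𝒱.vir eulerSeries (𝒱.wres h u v) =
      𝒱.wres h (𝒱.vir eulerSeries u) v + 𝒱.wres h u (𝒱.vir eulerSeries v) -
        𝒱.wres (h + oneAdd * logSeries * LaurentSeries.deriv h) u v := by
  induction u using 𝒱.grade_induction with
  | h0 => simp
  | hadd u w hu hw =>
    simp only [map_add, LinearMap.add_apply, hu, hw]
    abel
  | hg k u hu =>
    obtain ⟨K, hK⟩ := 𝒱.exists_mode_eq_zero 𝒱.omega u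
    have hc := 𝒱.res_commutator (oneAdd * logSeries) (h * oneAdd ^ (k - 1)) 𝒱.omega u v (K + 2)
      (fun i hi => hK i (by omega))
    rw [sub_eq_iff_eq_add, Finset.sum_range_succ', Finset.sum_range_succ', zero_add,
      hasseDeriv_zero, hasseDeriv_one_eq, deriv_eulerSeries, LinearMap.id_apply, Nat.cast_zero,
      Nat.cast_one, ← L_neg_one_eq, ← L_zero_eq, res_L_neg_one, L_zero_of_mem 𝒱 hu, map_smul,
      LinearMap.smul_apply] at hc
    have hE : 𝒱.vir eulerSeries u = ∑ i ∈ Finset.range K,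
        PowerSeries.coeff (i + 2) eulerSeries • 𝒱.mode 𝒱.omega (i + 2 : ℕ) u + (k : ℂ) • u := by
      rw [vir_apply, 𝒱.res_ofPowerSeries_eq_sum _ (K := K + 2) (fun i hi => hK i (by omega)),
        Finset.sum_range_succ', Finset.sum_range_succ', zero_add, coeff_zero_eulerSeries,
        coeff_one_eulerSeries, Nat.cast_one, ← L_zero_eq, L_zero_of_mem 𝒱 hu, zero_smul, add_zero,
        one_smul]
    -- The vector ω_{i+2} u has weight k - 1 - i, so the power of 1 + y in the derivative converts
    -- the weight factor of u into that of ω_{i+2} u.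
    have hsum : ∀ i ∈ Finset.range K,
        𝒱.res (hasseDeriv ℂ (i + 1 + 1) (oneAdd * logSeries) * (h * oneAdd ^ (k - 1)))
          (𝒱.mode 𝒱.omega (i + 1 + 1 : ℕ) u) v =
        PowerSeries.coeff (i + 2) eulerSeries •
          𝒱.wres h (𝒱.mode 𝒱.omega (i + 2 : ℕ) u) v := by
      intro i _
      rw [show i + 1 + 1 = i + 2 by ring, hasseDeriv_eulerSeries,
        wres_of_mem 𝒱 _ (𝒱.mode_mem_grade 𝒱.omega_mem hu _), ← HahnSeries.C_mul_eq_smul,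
        mul_assoc, HahnSeries.C_mul_eq_smul, map_smul, LinearMap.smul_apply, LinearMap.smul_apply,
        mul_left_comm, ← zpow_add₀ oneAdd_ne_zero]
      congr 5
      push_cast
      ring_nf
    have hk : LaurentSeries.deriv (oneAdd * logSeries * (h * oneAdd ^ (k - 1))) =
        (logSeries + 1) * (h * oneAdd ^ (k - 1)) +
          (oneAdd * logSeries * LaurentSeries.deriv h) * oneAdd ^ (k - 1) +
          ((k : ℂ) - 1) • (logSeries * (h * oneAdd ^ (k - 1))) := by
      rw [deriv_mul, deriv_eulerSeries, deriv_mul, deriv_zpow, deriv_oneAdd,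
        zpow_sub_one₀ oneAdd_ne_zero (k - 1), ← HahnSeries.C_mul_eq_smul,
        show (((k - 1 : ℤ)) : ℂ) = (k : ℂ) - 1 by push_cast; ring]
      have := oneAdd_ne_zero
      generalize oneAdd ^ (k - 1) = z
      generalize (HahnSeries.C ((k : ℂ) - 1) : LaurentSeries ℂ) = c
      field_simp
      ring
    rw [wres_of_mem 𝒱 _ hu, vir_apply, ofPowerSeries_eulerSeries, hc,
      Finset.sum_congr rfl hsum, hk, hE, wres_add, wres_of_mem 𝒱 _ hu, wres_of_mem 𝒱 _ hu,
      vir_apply, ofPowerSeries_eulerSeries]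
    simp only [map_sum, map_smul, map_add, LinearMap.add_apply, LinearMap.sum_apply, LinearMap.smul_apply,
      add_mul, one_mul, wres_of_mem 𝒱 _ hu]
    module

/-! ### The change of variables formula -/

/-- The field (1 + y) log(1 + y) d/dy is the Euler field in the coordinate log(1 + y), hence powers
of the logarithm are eigenvectors. -/
theorem oneAdd_mul_logSeries_mul_deriv_zpow (n : ℤ) :
    oneAdd * logSeries * LaurentSeries.deriv (logSeries ^ n) = (n : ℂ) • logSeries ^ n := by
  rw [deriv_zpow, deriv_logSeries, zpow_sub_one₀ logSeries_ne_zero, ← HahnSeries.C_mul_eq_smul]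
  have h1 := oneAdd_ne_zero
  have h2 := logSeries_ne_zero
  field_simp

theorem vir_eulerSeries_sub_mem_filt {n : ℤ} {v : V} (hv : v ∈ 𝒱.filt n) :
    𝒱.vir eulerSeries v - 𝒱.L 0 v ∈ 𝒱.filt (n - 1) := by
  have := 𝒱.vir_mem_filt X_sq_dvd_eulerSeries_sub hv
  rwa [map_sub, LinearMap.sub_apply, vir_X,
    show n + 1 - (2 : ℕ) = n - 1 by push_cast; ring] at this

/-- An eigenvector of `L[0]` whose weights are smaller than the eigenvalue vanishes. -/
theorem eq_zero_of_vir_eulerSeries {m : ℤ} {v : V} (hv : v ∈ 𝒱.filt (m - 1))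
    (h : 𝒱.vir eulerSeries v = (m : ℂ) • v) : v = 0 := by
  refine 𝒱.eq_zero_of_filt fun n hn => ?_
  rcases lt_or_ge (m - 1) n with hm | hm
  · exact hv n hm
  -- On a top component of weight n < m, L[0] acts as n, while the hypothesis says m.
  · have h1 := 𝒱.vir_eulerSeries_sub_mem_filt hn n (by omega)
    rw [component_sub, component_L_zero, h, component_smul, ← sub_smul, smul_eq_zero] at h1
    refine h1.resolve_left ?_
    rw [sub_eq_zero, Int.cast_inj]
    omega

/-- The difference of the two sides is an L[0]-eigenvector whose weights all lie below its
eigenvalue, hence zero. -/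
theorem uEnd_mode_of_mem {k l : ℤ} {u v : V} (hu : u ∈ 𝒱.grade k) (hv : v ∈ 𝒱.grade l) (n : ℤ) :
    𝒱.uEnd (𝒱.mode u n v) =
      κ ^ (-n - 1) • 𝒱.wres (logSeries ^ n) (𝒱.uEnd u) (𝒱.uEnd v) := by
  have h0 := twoPiI_ne_zero
  have hm := 𝒱.mode_mem_grade hu hv n
  have hmon : Monic n (logSeries ^ n) := by
    simpa using monic_logSeries.zpow n
  rw [← sub_eq_zero]
  refine 𝒱.eq_zero_of_vir_eulerSeries (m := k + l - n - 1) ?_ ?_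
  · have h1 := 𝒱.uEnd_sub_mem_filt hm
    have h2 := 𝒱.wres_mem_filt hmon.1 (𝒱.uEnd_sub_mem_filt hu)
      (𝒱.uEnd_mem_filt (𝒱.grade_le_filt le_rfl hv))
    have h3 := 𝒱.wres_mem_filt hmon.1 (𝒱.grade_le_filt le_rfl hu) (𝒱.uEnd_sub_mem_filt hv)
    have h4 := 𝒱.wres_sub_mode_mem_filt hmon hu (𝒱.grade_le_filt le_rfl hv)
    rw [show k - 1 + l - n - 1 = k + l - n - 1 - 1 by ring] at h2
    rw [show k + (l - 1) - n - 1 = k + l - n - 1 - 1 by ring] at h3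
    rw [show k + l - n - 2 = k + l - n - 1 - 1 by ring] at h4
    -- Up to lower weights, 𝒰(1) acts on u, v and u_n v as κ to the weight, and the weighted residue
    -- is u_n v. Both leading terms are then κ^{k+l-n-1} u_n v.
    have h5 := sub_mem h1 (Submodule.smul_mem _ (κ ^ (-n - 1)) (add_mem h2
      (Submodule.smul_mem _ (κ ^ k) (add_mem h3 (Submodule.smul_mem _ (κ ^ l) h4)))))
    convert h5 using 1
    have e : κ ^ (k + l - n - 1) = κ ^ (-n - 1) * (κ ^ k * κ ^ l) := by
      rw [← zpow_add₀ h0, ← zpow_add₀ h0]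
      congr 1
      ring
    rw [e]
    simp only [map_sub, map_smul, LinearMap.sub_apply, LinearMap.smul_apply]
    module
  -- The Leibniz rule gives the eigenvalue k + l - (n + 1): the kernel log(1 + y)^n contributes n,
  -- and the unchanged copy of it contributes 1.
  · rw [map_sub, map_smul, vir_wres, vir_uEnd, vir_uEnd, vir_uEnd, L_zero_of_mem 𝒱 hm,
      L_zero_of_mem 𝒱 hu, L_zero_of_mem 𝒱 hv, oneAdd_mul_logSeries_mul_deriv_zpow, wres_add,
      wres_smul]
    simp only [map_smul, LinearMap.smul_apply]
    push_cast
    module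

theorem uEnd_mode (u v : V) (n : ℤ) :
    𝒱.uEnd (𝒱.mode u n v) =
      κ ^ (-n - 1) • 𝒱.wres (logSeries ^ n) (𝒱.uEnd u) (𝒱.uEnd v) := by
  induction u using 𝒱.grade_induction with
  | h0 => simp [mode_zero_left]
  | hadd u w hu hw =>
    simp only [mode_add, map_add, LinearMap.add_apply, hu, hw, smul_add]
  | hg k u hu =>
    induction v using 𝒱.grade_induction with
    | h0 => simp
    | hadd v w hv hw => simp only [map_add, hv, hw, smul_add]
    | hg l v hv => exact 𝒱.uEnd_mode_of_mem hu hv n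

/-- The change of variables formula
`𝒰(1) Y(u, x) v = Y(e^{2πix L(0)} 𝒰(1) u, e^{2πix} - 1) 𝒰(1) v`. -/
theorem uEnd_res (f : LaurentSeries ℂ) (u v : V) :
    𝒱.uEnd (𝒱.res f u v) = κ⁻¹ • 𝒱.wres (logSubst f) (𝒱.uEnd u) (𝒱.uEnd v) := by
  obtain ⟨N, hN⟩ := 𝒱.exists_res_eq_zero u v
  obtain ⟨M, hM⟩ := 𝒱.exists_wres_eq_zero (𝒱.uEnd u) (𝒱.uEnd v)
  refine induction_order
    (P := fun f => 𝒱.uEnd (𝒱.res f u v) =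
      κ⁻¹ • 𝒱.wres (logSubst f) (𝒱.uEnd u) (𝒱.uEnd v))
    (max N M) (fun f hf => ?_) (fun f g hf hg => ?_) (fun n c => ?_) f
  · rw [hN f (hf.mono (by omega)), hM _ (hf.mono (le_max_right _ _)).logSubst, map_zero, smul_zero]
  · rw [map_add, LinearMap.add_apply, LinearMap.add_apply, map_add, hf, hg, map_add, wres_add,
      smul_add]
  · have e : HahnSeries.single n c = c • HahnSeries.single n (1 : ℂ) := by
      ext m
      simp [HahnSeries.coeff_single]
    rw [res_single, map_smul, uEnd_mode, e, logSubst_smul, wres_smul, logSubst_single, wres_smul,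
      smul_comm κ⁻¹ c, smul_smul κ⁻¹]
    congr 2
    rw [zpow_sub_one₀ twoPiI_ne_zero, mul_comm]

theorem wres_div_of_mem {k : ℤ} {u : V} (hu : u ∈ 𝒱.grade k) (n : ℕ) (v : V) :
    𝒱.wres (oneAdd / HahnSeries.single 1 1 ^ n) u v = 𝒱.res (zhuKernel k n) u v := by
  rw [wres_of_mem 𝒱 _ hu, zpow_sub_one₀ oneAdd_ne_zero, zhuKernel]
  congr 3
  have := oneAdd_ne_zero
  rw [← oneAdd]
  field_simp

theorem uEnd_res_bulletKernel (n : ℕ) (u v : V) :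
    𝒱.uEnd (𝒱.res (bulletKernel n) u v) =
      𝒱.wres (oneAdd / HahnSeries.single 1 1 ^ n) (𝒱.uEnd u) (𝒱.uEnd v) := by
  rw [uEnd_res, logSubst_bulletKernel, wres_smul, smul_smul, inv_mul_cancel₀ twoPiI_ne_zero,
    one_smul]

theorem zhuMul_eq (u v : V) : 𝒱.zhuMul u v = 𝒱.wres (oneAdd / HahnSeries.single 1 1 ^ 1) u v := by
  have h := 𝒱.finsum_component (fun k => (𝒱.res (zhuKernel k 1)).flip v) u
  simp only [LinearMap.flip_apply] at h
  change ∑ᶠ k : ℤ, 𝒱.res (zhuKernel k 1) (𝒱.component k u) v = _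
  rw [h]
  clear h
  induction u using 𝒱.grade_induction with
  | h0 => simp
  | hadd u w hu hw => simp only [map_add, LinearMap.add_apply, hu, hw]
  | hg k u hu => rw [ofComponents_of_mem 𝒱 _ hu, wres_div_of_mem 𝒱 hu]; rfl

theorem uEnd_bullet (u v : V) : 𝒱.uEnd (𝒱.bullet u v) = 𝒱.zhuMul (𝒱.uEnd u) (𝒱.uEnd v) := by
  rw [bullet_eq_res, uEnd_res_bulletKernel, zhuMul_eq]

theorem zhuO_eq_span : 𝒱.zhuO = Submodule.span ℂ
    {x | ∃ u v : V, x = 𝒱.wres (oneAdd / HahnSeries.single 1 1 ^ 2) u v} := by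
  apply le_antisymm
  · rw [zhuO, Submodule.span_le]
    rintro _ ⟨k, u, hu, v, rfl⟩
    exact Submodule.subset_span ⟨u, v, (𝒱.wres_div_of_mem hu 2 v).symm⟩
  · rw [Submodule.span_le]
    rintro _ ⟨u, v, rfl⟩
    induction u using 𝒱.grade_induction with
    | h0 => simp
    | hadd u w hu hw => rw [map_add, LinearMap.add_apply]; exact add_mem hu hw
    | hg k u hu =>
      rw [wres_div_of_mem 𝒱 hu]
      exact Submodule.subset_span ⟨k, u, hu, v, rfl⟩

/-- Both spaces are spanned by their generators of index 2, which correspond under 𝒰(1);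
surjectivity of 𝒰(1) ensures that every generator of O(V) is reached. -/
theorem map_uEnd_OTilde : 𝒱.OTilde.map 𝒱.uEnd = 𝒱.zhuO := by
  rw [OTilde_eq_span, zhuO_eq_span, Submodule.map_span]
  congr 1
  ext x
  constructor
  · rintro ⟨_, ⟨u, v, rfl⟩, rfl⟩
    exact ⟨_, _, 𝒱.uEnd_res_bulletKernel 2 u v⟩
  · rintro ⟨u, v, rfl⟩
    obtain ⟨u, rfl⟩ := 𝒱.uEnd_surjective u
    obtain ⟨v, rfl⟩ := 𝒱.uEnd_surjective v
    exact ⟨_, ⟨u, v, rfl⟩, 𝒱.uEnd_res_bulletKernel 2 u v⟩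

/-- `𝒰(1)` as a linear automorphism. -/
def uEquiv : V ≃ₗ[ℂ] V :=
  LinearEquiv.ofBijective 𝒱.uEnd ⟨𝒱.uEnd_injective, 𝒱.uEnd_surjective⟩

/-- The isomorphism `Ã(V) → A(V)` induced by `𝒰(1)`. -/
def tildeEquiv : 𝒱.ATilde ≃ₗ[ℂ] 𝒱.ZhuA :=
  Submodule.Quotient.equiv 𝒱.OTilde 𝒱.zhuO 𝒱.uEquiv 𝒱.map_uEnd_OTilde

theorem tildeEquiv_mkQ (u : V) :
    𝒱.tildeEquiv (𝒱.OTilde.mkQ u) = 𝒱.zhuO.mkQ (𝒱.uEnd u) := rfl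

/-- The product of Zhu's algebra. -/
def mulZhu : 𝒱.ZhuA →ₗ[ℂ] 𝒱.ZhuA →ₗ[ℂ] 𝒱.ZhuA :=
  (𝒱.mulTilde.compl₁₂ 𝒱.tildeEquiv.symm.toLinearMap 𝒱.tildeEquiv.symm.toLinearMap).compr₂
    𝒱.tildeEquiv.toLinearMap

theorem mulZhu_tildeEquiv (a b : 𝒱.ATilde) :
    𝒱.mulZhu (𝒱.tildeEquiv a) (𝒱.tildeEquiv b) = 𝒱.tildeEquiv (𝒱.mulTilde a b) := by
  simp [mulZhu]

theorem mulZhu_mkQ (u v : V) :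
    𝒱.mulZhu (𝒱.zhuO.mkQ u) (𝒱.zhuO.mkQ v) = 𝒱.zhuO.mkQ (𝒱.zhuMul u v) := by
  obtain ⟨u, rfl⟩ := 𝒱.uEnd_surjective u
  obtain ⟨v, rfl⟩ := 𝒱.uEnd_surjective v
  rw [← tildeEquiv_mkQ, ← tildeEquiv_mkQ, mulZhu_tildeEquiv, mulTilde_mkQ, tildeEquiv_mkQ,
    uEnd_bullet]

theorem tildeEquiv_vacuum :
    𝒱.tildeEquiv (𝒱.OTilde.mkQ 𝒱.vacuum) = 𝒱.zhuO.mkQ 𝒱.vacuum := by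
  rw [tildeEquiv_mkQ, uEnd_vacuum]

/-- Transported along the isomorphism from Ã(V), so no separate verification for Zhu's product is
needed. -/
theorem isUnitalAssociative_mulZhu :
    IsUnitalAssociative 𝒱.mulZhu (𝒱.zhuO.mkQ 𝒱.vacuum) := by
  obtain ⟨h1, h2⟩ := 𝒱.isUnitalAssociative_mulTilde
  refine ⟨fun a b c => ?_, fun a => ?_⟩
  · obtain ⟨a, rfl⟩ := 𝒱.tildeEquiv.surjective a
    obtain ⟨b, rfl⟩ := 𝒱.tildeEquiv.surjective b
    obtain ⟨c, rfl⟩ := 𝒱.tildeEquiv.surjective c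
    simp only [mulZhu_tildeEquiv, h1]
  · obtain ⟨a, rfl⟩ := 𝒱.tildeEquiv.surjective a
    rw [← tildeEquiv_vacuum, mulZhu_tildeEquiv, mulZhu_tildeEquiv, (h2 a).1, (h2 a).2]
    exact ⟨rfl, rfl⟩

end VertexOperatorAlgebra

end

theorem proposition6p1 {V : Type*} [AddCommGroup V] [Module ℂ V]
    (𝒱 : VertexOperatorAlgebra V) :
    -- `μ` is the product of `Ã(V)`, `ν` is the product of Zhu's algebra `A(V)`
    ∃ (μ : 𝒱.ATilde →ₗ[ℂ] 𝒱.ATilde →ₗ[ℂ] 𝒱.ATilde)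
      (ν : 𝒱.ZhuA →ₗ[ℂ] 𝒱.ZhuA →ₗ[ℂ] 𝒱.ZhuA)
      (φ : 𝒱.ATilde ≃ₗ[ℂ] 𝒱.ZhuA),
      (∀ u v : V, μ (𝒱.OTilde.mkQ u) (𝒱.OTilde.mkQ v) = 𝒱.OTilde.mkQ (𝒱.bullet u v)) ∧
      IsUnitalAssociative μ (𝒱.OTilde.mkQ 𝒱.vacuum) ∧
      (∀ u v : V, 𝒱.bullet (𝒱.L (-1) u) v ∈ 𝒱.OTilde) ∧
      (∀ u v : V, 𝒱.bullet u v -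
        (𝒱.bullet v u - (2 * Real.pi * Complex.I : ℂ) • 𝒱.mode v 0 u) ∈ 𝒱.OTilde) ∧
      (∀ u v : V, 𝒱.bullet u v -
        (𝒱.bullet v u + (2 * Real.pi * Complex.I : ℂ) • 𝒱.mode u 0 v) ∈ 𝒱.OTilde) ∧
      (∀ a : 𝒱.ATilde, μ (𝒱.OTilde.mkQ 𝒱.omega) a = μ a (𝒱.OTilde.mkQ 𝒱.omega)) ∧
      (∀ u v : V, ν (𝒱.zhuO.mkQ u) (𝒱.zhuO.mkQ v) = 𝒱.zhuO.mkQ (𝒱.zhuMul u v)) ∧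
      IsUnitalAssociative ν (𝒱.zhuO.mkQ 𝒱.vacuum) ∧
      (∀ u : V, φ (𝒱.OTilde.mkQ u) = 𝒱.zhuO.mkQ (𝒱.U1 u)) ∧
      (∀ a b : 𝒱.ATilde, φ (μ a b) = ν (φ a) (φ b)) ∧
      φ (𝒱.OTilde.mkQ 𝒱.vacuum) = 𝒱.zhuO.mkQ 𝒱.vacuum := by
  refine ⟨𝒱.mulTilde, 𝒱.mulZhu, 𝒱.tildeEquiv, 𝒱.mulTilde_mkQ, 𝒱.isUnitalAssociative_mulTilde,
    𝒱.bullet_L_neg_one_mem, 𝒱.bullet_sub_bullet_mem', 𝒱.bullet_sub_bullet_mem, 𝒱.omega_mem_center,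
    𝒱.mulZhu_mkQ, 𝒱.isUnitalAssociative_mulZhu, fun u => ?_,
    fun a b => (𝒱.mulZhu_tildeEquiv a b).symm, 𝒱.tildeEquiv_vacuum⟩
  rw [VertexOperatorAlgebra.U1_eq]
  exact 𝒱.tildeEquiv_mkQ u
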